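/- Let $p$ be a prime, $N\in\mathbb Z$, $\alpha>0$, $1\le q<\infty$. Let $dx$ be the Haar measure on $\mathbb Q_p$ with $\int_{\mathbb Z_p}dx=1$, let $B_N=\{x\in\mathbb Q_p:\ |x|_p\le p^N\}$, let $\chi(x)=\exp(2\pi i\{x\}_p)$ where $\{x\}_p$ is the fractional part of $x$, and let $\mathcal D(B_N)$ be the space of complex-valued locally constant functions on $\mathbb Q_p$ with support in $B_N$ (identified with the space of all locally constant functions on $B_N$). For a test function $\varphi$ let $$(D^\alpha\varphi)(x)=\mathcal F^{-1}_{\xi\to x}\left[|\xi|_p^\alpha\,\mathcal F_{y\to\xi}\varphi\right],\qquad (\mathcal F\varphi)(\xi)=\int_{\mathbb Q_p}\chi(y\xi)\varphi(y)\,dy,$$ be the Vladimirov operator, and let $D_N^\alpha\varphi$ be the restriction of $D^\alpha\varphi$ to $B_N$ for $\varphi\in\mathcal D(B_N)$. Put $\lambda_\alpha=\frac{p-1}{p^{\alpha+1}-1}p^{\alpha(1-N)}$, and, for $t>0$, $$Z_\alpha(t,x)=\int_{\mathbb Q_p}\chi(\xi x)e^{-t|\xi|_p^\alpha}\,d\xi,\qquad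 Z_N^{(\alpha)}(t,x)=e^{\lambda_\alpha t}Z_\alpha(t,x)+c(t),$$ $$c(t)=p^{-N}-p^{-N}(1-p^{-1})e^{\lambda_\alpha t}\sum_{n=0}^\infty\frac{(-1)^n}{n!}t^n\frac{p^{-N\alpha n}}{1-p^{-\alpha n-1}},$$ $$(T_N^{(\alpha)}(t)\psi)(x)=\int_{B_N}Z_N^{(\alpha)}(t,x-y)\psi(y)\,dy,\qquad \psi\in L^q(B_N),\ x\in B_N.$$ Let $A_q^{(\alpha)}$ be the generator of the semigroup $T_N^{(\alpha)}$ on $L^q(B_N)$, with the sign convention $T_N^{(\alpha)}(t)=e^{-tA_q^{(\alpha)}}$; that is, $A_q^{(\alpha)}u=\lim_{t\to0+}t^{-1}(u-T_N^{(\alpha)}(t)u)$ in $L^q(B_N)$, on the domain $D(A_q^{(\alpha)})$ of all $u\in L^q(B_N)$ for which this limit exists. Then $\mathcal D(B_N)\subset D(A_q^{(\alpha)})$, and $A_q^{(\alpha)}\varphi=D_N^\alpha\varphi-\lambda_\alpha\varphi$ almost everywhere on $B_N$ for all $\varphi\in\mathcal D(B_N)$. Moreover, $\mathcal D(B_N)$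 is dense in $D(A_q^{(\alpha)})$ with respect to the graph norm: for every $u\in D(A_q^{(\alpha)})$ and every $\varepsilon>0$ there is $\varphi\in\mathcal D(B_N)$ such that $$\|u-\varphi\|_{L^q(B_N)}+\left\|A_q^{(\alpha)}u-A_q^{(\alpha)}\varphi\right\|_{L^q(B_N)}<\varepsilon .$$ -/

import Mathlib

open MeasureTheory Filter Topology
open scoped ENNReal

noncomputable section

/-! ### Generator of a one-parameter family of operators -/

section Generator

variable {E : Type*} [NormedAddCommGroup E] [NormedSpace ℂ E]

/-- The generator `A` of a one-parameter (semi)group `T t = exp (-t A)`: its domain consists of all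
`u` for which `lim_{t → 0+} (u - T t u) / t` exists in norm, and `A u` is this limit. -/
def semigroupGenerator (T : ℝ → E →ₗ[ℂ] E) : E →ₗ.[ℂ] E where
  domain :=
    { carrier := {u | ∃ v, Tendsto (fun t : ℝ => (t : ℂ)⁻¹ • (u - T t u)) (𝓝[>] 0) (𝓝 v)}
      zero_mem' := ⟨0, by simp⟩
      add_mem' := by
        rintro a b ⟨v, hv⟩ ⟨w, hw⟩
        refine ⟨v + w, (hv.add hw).congr fun t => ?_⟩
        rw [map_add, ← smul_add]
        congr 1
        abel
      smul_mem' := by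
        rintro c a ⟨v, hv⟩
        refine ⟨c • v, (hv.const_smul c).congr fun t => ?_⟩
        rw [map_smul, ← smul_sub, smul_comm] }
  toFun :=
    { toFun := fun u => u.2.choose
      map_add' := by
        intro a b
        refine tendsto_nhds_unique (a + b).2.choose_spec
          ((a.2.choose_spec.add b.2.choose_spec).congr fun t => ?_)
        rw [Submodule.coe_add, map_add, ← smul_add]
        congr 1
        abel
      map_smul' := by
        intro c a
        refine tendsto_nhds_unique (c • a).2.choose_spec
          ((a.2.choose_spec.const_smul c).congr fun t => ?_)
        rw [Submodule.coe_smul, map_smul, ← smul_sub, smul_comm] }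

/-- The graph norm `‖u‖ + ‖A u‖` on the domain of an operator `A`. -/
def graphNorm (A : E →ₗ.[ℂ] E) (u : A.domain) : ℝ := ‖(u : E)‖ + ‖A u‖

end Generator

/-! ### The field of `p`-adic numbers: Haar measure, balls, the standard additive character -/

namespace Vladimirov

variable (p : ℕ) [Fact p.Prime]

instance : MeasurableSpace ℚ_[p] := borel ℚ_[p]

instance : BorelSpace ℚ_[p] := ⟨rfl⟩

/-- The Haar measure `dx` on `ℚ_p`, normalized by `∫_{ℤ_p} dx = 1`. -/
def haar : Measure ℚ_[p] :=
  Measure.addHaarMeasure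
    { carrier := Metric.closedBall 0 1
      isCompact' := isCompact_closedBall 0 1
      interior_nonempty' :=
        ⟨0, Metric.ball_subset_interior_closedBall (Metric.mem_ball_self one_pos)⟩ }

instance : (haar p).IsAddHaarMeasure := by unfold haar; infer_instance

/-- The ball `B_N = {x : |x|_p ≤ p ^ N}`. -/
def ball (N : ℤ) : Set ℚ_[p] := {x | ‖x‖ ≤ (p : ℝ) ^ N}

lemma ball_eq (N : ℤ) : ball p N = Metric.closedBall 0 ((p : ℝ) ^ N) := by
  ext x
  simp [ball]

lemma isCompact_ball (N : ℤ) : IsCompact (ball p N) := by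
  rw [ball_eq]
  exact isCompact_closedBall _ _

/-- The Haar measure restricted to the ball `B_N`. -/
def ballMeasure (N : ℤ) : Measure ℚ_[p] := (haar p).restrict (ball p N)

instance (N : ℤ) : IsFiniteMeasure (ballMeasure p N) :=
  ⟨by rw [ballMeasure, Measure.restrict_apply_univ]; exact (isCompact_ball p N).measure_lt_top⟩

variable {p}

lemma norm_mul_pow_le_one (x : ℚ_[p]) : ‖x * (p : ℚ_[p]) ^ (-x.valuation).toNat‖ ≤ 1 := by
  by_cases hx : x = 0
  · simp [hx]
  have hp : (1 : ℝ) ≤ p := by exact_mod_cast (Fact.out : p.Prime).one_lt.le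
  have hp0 : (p : ℝ) ≠ 0 := by positivity
  rw [norm_mul, norm_pow, Padic.norm_p, Padic.norm_eq_zpow_neg_valuation hx, ← zpow_natCast,
    inv_zpow', ← zpow_add₀ hp0]
  exact zpow_le_one_of_nonpos₀ hp (by have := Int.self_le_toNat (-x.valuation); omega)

/-- The fractional part `{x}_p`: if `|x|_p = p ^ k` with `k > 0` and
`x = p ^ (-k) * (x₀ + x₁ p + ⋯)` with digits `xᵢ ∈ {0, …, p - 1}`, then
`{x}_p = p ^ (-k) * (x₀ + ⋯ + x_{k-1} p ^ (k-1))`; otherwise `{x}_p = 0`. -/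
def fracPart (x : ℚ_[p]) : ℚ :=
  (PadicInt.appr ⟨x * (p : ℚ_[p]) ^ (-x.valuation).toNat, norm_mul_pow_le_one x⟩
    (-x.valuation).toNat : ℚ) / (p : ℚ) ^ (-x.valuation).toNat

/-- The additive character `χ (x) = exp (2 π i {x}_p)`. -/
def chi (x : ℚ_[p]) : ℂ := Complex.exp (2 * Real.pi * Complex.I * (fracPart x : ℂ))

lemma norm_chi (x : ℚ_[p]) : ‖chi x‖ = 1 := by
  have : (2 * Real.pi * Complex.I * (fracPart x : ℂ) : ℂ)
      = ((2 * Real.pi * (fracPart x : ℝ) : ℝ) : ℂ) * Complex.I := by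
    push_cast; ring
  rw [chi, this, Complex.norm_exp_ofReal_mul_I]

lemma norm_sub_fracPart_le (x : ℚ_[p]) : ‖x - (fracPart x : ℚ_[p])‖ ≤ 1 := by
  have hp0 : (p : ℚ_[p]) ≠ 0 := by exact_mod_cast (Fact.out : p.Prime).ne_zero
  set k := (-x.valuation).toNat with hk
  have h := PadicInt.appr_spec k ⟨x * (p : ℚ_[p]) ^ k, norm_mul_pow_le_one x⟩
  rw [← PadicInt.norm_le_pow_iff_mem_span_pow, PadicInt.norm_def] at h
  have e : x - (fracPart x : ℚ_[p])
      = (x * (p : ℚ_[p]) ^ k - (PadicInt.appr ⟨x * (p : ℚ_[p]) ^ k, norm_mul_pow_le_one x⟩ k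
        : ℚ_[p])) / (p : ℚ_[p]) ^ k := by
    have e' : (fracPart x : ℚ_[p])
        = (PadicInt.appr ⟨x * (p : ℚ_[p]) ^ k, norm_mul_pow_le_one x⟩ k : ℚ_[p])
          / (p : ℚ_[p]) ^ k := by
      unfold fracPart
      push_cast
      rfl
    rw [e', sub_div, mul_div_cancel_right₀ _ (pow_ne_zero _ hp0)]
  have hp : (0 : ℝ) < p := by exact_mod_cast (Fact.out : p.Prime).pos
  rw [e, norm_div, norm_pow, Padic.norm_p, div_le_one (by positivity)]
  refine h.trans (le_of_eq ?_)
  rw [zpow_neg, zpow_natCast, inv_pow]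

lemma fracPart_spec (x : ℚ_[p]) :
    0 ≤ fracPart x ∧ fracPart x < 1 ∧ ∃ k : ℕ, ∃ a : ℤ, fracPart x = a / (p : ℚ) ^ k := by
  have hp : (0 : ℚ) < p := by exact_mod_cast (Fact.out : p.Prime).pos
  refine ⟨by unfold fracPart; positivity, ?_, ⟨_, _, rfl⟩⟩
  unfold fracPart
  rw [div_lt_one (by positivity)]
  exact_mod_cast PadicInt.appr_lt _ _

lemma fracPart_eq_of_norm_sub_le {x y : ℚ_[p]} (h : ‖x - y‖ ≤ 1) : fracPart x = fracPart y := by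
  obtain ⟨hx0, hx1, k, a, hx⟩ := fracPart_spec x
  obtain ⟨hy0, hy1, l, b, hy⟩ := fracPart_spec y
  have hp : (p : ℚ) ≠ 0 := by exact_mod_cast (Fact.out : p.Prime).ne_zero
  have hpp : (p : ℚ_[p]) ≠ 0 := by exact_mod_cast (Fact.out : p.Prime).ne_zero
  have hn : ‖((fracPart x - fracPart y : ℚ) : ℚ_[p])‖ ≤ 1 := by
    have e : ((fracPart x - fracPart y : ℚ) : ℚ_[p])
        = (x - y) - ((x - (fracPart x : ℚ_[p])) - (y - (fracPart y : ℚ_[p]))) := by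
      push_cast; ring
    rw [e]
    have hs (z w : ℚ_[p]) : ‖z - w‖ ≤ max ‖z‖ ‖w‖ := by
      rw [sub_eq_add_neg, ← norm_neg w]
      exact Padic.nonarchimedean _ _
    exact (hs _ _).trans (max_le h ((hs _ _).trans
      (max_le (norm_sub_fracPart_le x) (norm_sub_fracPart_le y))))
  have hd : fracPart x - fracPart y = ((a * p ^ l - b * p ^ k : ℤ) : ℚ) / (p : ℚ) ^ (k + l) := by
    rw [hx, hy]
    push_cast
    field_simp
    ring
  have hdvd : ((p ^ (k + l) : ℕ) : ℤ) ∣ (a * p ^ l - b * p ^ k : ℤ) := by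
    rw [hd] at hn
    push_cast at hn
    rw [norm_div, norm_pow, Padic.norm_p, div_le_one (by
      have : (0 : ℝ) < p := by exact_mod_cast (Fact.out : p.Prime).pos
      positivity)] at hn
    have := (Padic.norm_int_le_pow_iff_dvd (p := p) (a * p ^ l - b * p ^ k : ℤ) (k + l)).1 (by
      push_cast
      refine hn.trans (le_of_eq ?_)
      rw [← Nat.cast_add, zpow_neg, zpow_natCast, inv_pow])
    exact_mod_cast this
  obtain ⟨c, hc⟩ := hdvd
  have hc' : fracPart x - fracPart y = c := by
    rw [hd, hc]
    push_cast
    field_simp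
  have h1 : (c : ℚ) < 1 := by linarith
  have h2 : (-1 : ℚ) < c := by linarith
  have h1' : c < 1 := by exact_mod_cast h1
  have h2' : -1 < c := by exact_mod_cast h2
  have : c = 0 := by omega
  rw [this] at hc'
  push_cast at hc'
  linarith

lemma isLocallyConstant_chi : IsLocallyConstant (chi : ℚ_[p] → ℂ) := by
  rw [IsLocallyConstant.iff_eventually_eq]
  intro x
  filter_upwards [Metric.closedBall_mem_nhds x one_pos] with y hy
  rw [chi, chi, fracPart_eq_of_norm_sub_le (by simpa [dist_eq_norm] using hy)]

lemma continuous_chi : Continuous (chi : ℚ_[p] → ℂ) := isLocallyConstant_chi.continuous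

/-! ### The Vladimirov operator and the heat kernels -/

/-- The Fourier transform `(F f)(ξ) = ∫ χ(x ξ) f(x) dx`. -/
def fourier (f : ℚ_[p] → ℂ) (ξ : ℚ_[p]) : ℂ := ∫ x, chi (x * ξ) * f x ∂(haar p)

/-- The inverse Fourier transform `(F⁻¹ g)(x) = ∫ χ(-x ξ) g(ξ) dξ`. -/
def fourierInv (g : ℚ_[p] → ℂ) (x : ℚ_[p]) : ℂ := ∫ ξ, chi (-(x * ξ)) * g ξ ∂(haar p)

/-- The Vladimirov operator `D^α u = F⁻¹ (|ξ|_p ^ α F u)` (used for test functions `u`). -/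
def vladimirov (α : ℝ) (u : ℚ_[p] → ℂ) : ℚ_[p] → ℂ :=
  fourierInv fun ξ => ((‖ξ‖ ^ α : ℝ) : ℂ) * fourier u ξ

variable (p) in
/-- `λ_α = (p - 1) / (p ^ (α + 1) - 1) * p ^ (α (1 - N))`. -/
def lam (N : ℤ) (α : ℝ) : ℝ :=
  ((p : ℝ) - 1) / ((p : ℝ) ^ (α + 1) - 1) * (p : ℝ) ^ (α * (1 - (N : ℝ)))

/-- The heat kernel `Z_α (t, x) = ∫ χ(ξ x) exp (-t |ξ|_p ^ α) dξ` on `ℚ_p`. -/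
def heatKernel (α t : ℝ) (x : ℚ_[p]) : ℂ :=
  ∫ ξ, chi (ξ * x) * (Real.exp (-t * ‖ξ‖ ^ α) : ℂ) ∂(haar p)

variable (p) in
/-- `c(t) = p^{-N} - p^{-N} (1 - p⁻¹) e^{λ_α t} ∑ (-1)^n / n! * t^n p^{-Nαn} / (1 - p^{-αn-1})`. -/
def cCoeff (N : ℤ) (α t : ℝ) : ℝ :=
  (p : ℝ) ^ (-N) - (p : ℝ) ^ (-N) * (1 - (p : ℝ)⁻¹) * Real.exp (lam p N α * t) *
    ∑' n : ℕ, (-1 : ℝ) ^ n / (n.factorial : ℝ) * t ^ n *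
      ((p : ℝ) ^ (-(N : ℝ) * α * n) / (1 - (p : ℝ) ^ (-α * n - 1)))

/-- The heat kernel `Z_N^{(α)} (t, x) = e^{λ_α t} Z_α (t, x) + c(t)` of the ball `B_N`. -/
def ballHeatKernel (N : ℤ) (α t : ℝ) (x : ℚ_[p]) : ℂ :=
  (Real.exp (lam p N α * t) : ℂ) * heatKernel α t x + (cCoeff p N α t : ℂ)

/-- `(T_N^{(α)} (t) ψ)(x) = ∫_{B_N} Z_N^{(α)} (t, x - y) ψ(y) dy`, on functions. -/
def ballConv (N : ℤ) (α t : ℝ) (f : ℚ_[p] → ℂ) (x : ℚ_[p]) : ℂ :=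
  ∫ y, ballHeatKernel N α t (x - y) * f y ∂(ballMeasure p N)

lemma measurable_ballHeatKernel (N : ℤ) (α t : ℝ) :
    Measurable (ballHeatKernel (p := p) N α t) := by
  have h : StronglyMeasurable (heatKernel (p := p) α t) := by
    refine StronglyMeasurable.integral_prod_right' (ν := haar p)
      (f := fun z : ℚ_[p] × ℚ_[p] => chi (z.2 * z.1) * (Real.exp (-t * ‖z.2‖ ^ α) : ℂ)) ?_
    refine Measurable.stronglyMeasurable (Measurable.mul ?_ (by fun_prop))
    exact (continuous_chi.comp (continuous_snd.mul continuous_fst)).measurable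
  unfold ballHeatKernel
  exact (h.measurable.const_mul _).add_const _

lemma exists_bound_ballHeatKernel (N : ℤ) (α t : ℝ) :
    ∃ C : ℝ, ∀ x : ℚ_[p], ‖ballHeatKernel N α t x‖ ≤ C := by
  have h : ∀ x : ℚ_[p], ‖heatKernel α t x‖ ≤ ∫ ξ : ℚ_[p], Real.exp (-t * ‖ξ‖ ^ α) ∂(haar p) := by
    intro x
    refine (norm_integral_le_integral_norm _).trans (le_of_eq (integral_congr_ae ?_))
    refine Eventually.of_forall fun ξ => ?_
    simp only [norm_mul, norm_chi, one_mul, Complex.norm_real, Real.norm_eq_abs, Real.abs_exp]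
  refine ⟨‖(Real.exp (lam p N α * t) : ℂ)‖ * (∫ ξ : ℚ_[p], Real.exp (-t * ‖ξ‖ ^ α) ∂(haar p))
    + ‖(cCoeff p N α t : ℂ)‖, fun x => ?_⟩
  refine (norm_add_le _ _).trans ?_
  rw [norm_mul]
  gcongr
  exact h x

lemma integrable_ballConv (N : ℤ) (α t : ℝ) {f : ℚ_[p] → ℂ} (hf : Integrable f (ballMeasure p N))
    (x : ℚ_[p]) :
    Integrable (fun y => ballHeatKernel N α t (x - y) * f y) (ballMeasure p N) := by
  obtain ⟨C, hC⟩ := exists_bound_ballHeatKernel (p := p) N α t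
  refine hf.bdd_mul (c := C) ?_ (Eventually.of_forall fun y => hC _)
  exact ((measurable_ballHeatKernel N α t).comp (by fun_prop)).aestronglyMeasurable

lemma memLp_ballConv (N : ℤ) (α t : ℝ) {q : ℝ≥0∞} (hq : 1 ≤ q) {f : ℚ_[p] → ℂ}
    (hf : MemLp f q (ballMeasure p N)) : MemLp (ballConv N α t f) q (ballMeasure p N) := by
  have hi : Integrable f (ballMeasure p N) := hf.integrable hq
  obtain ⟨C, hC⟩ := exists_bound_ballHeatKernel (p := p) N α t
  refine MemLp.of_bound ?_ (∫ y, C * ‖f y‖ ∂(ballMeasure p N)) (Eventually.of_forall fun x => ?_)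
  · refine AEStronglyMeasurable.integral_prod_right' (μ := ballMeasure p N) (ν := ballMeasure p N)
      (f := fun z : ℚ_[p] × ℚ_[p] => ballHeatKernel N α t (z.1 - z.2) * f z.2) ?_
    exact ((measurable_ballHeatKernel N α t).comp (by fun_prop)).aestronglyMeasurable.mul
      hf.1.comp_snd
  · refine (norm_integral_le_integral_norm _).trans
      (integral_mono (integrable_ballConv N α t hi x).norm (hi.norm.const_mul C) fun y => ?_)
    simp only [norm_mul]
    gcongr
    exact hC _

variable (p) in
/-- The space `L^q(B_N)` of complex-valued functions. -/
abbrev LqBall (N : ℤ) (q : ℝ≥0∞) : Type := Lp ℂ q (ballMeasure p N)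

variable (p) in
/-- The operators `T_N^{(α)} (t)`, `t > 0`, on `L^q(B_N)`, `q ≥ 1`: convolution on `B_N` with the
kernel `Z_N^{(α)} (t, ·)`. -/
def ballSemigroup (N : ℤ) (α : ℝ) (q : ℝ≥0∞) [hq : Fact (1 ≤ q)] (t : ℝ) :
    LqBall p N q →ₗ[ℂ] LqBall p N q where
  toFun f := (memLp_ballConv N α t hq.out (Lp.memLp f)).toLp _
  map_add' f g := by
    rw [← MemLp.toLp_add]
    refine MemLp.toLp_congr _ _ (Eventually.of_forall fun x => ?_)
    have hf : Integrable f (ballMeasure p N) := (Lp.memLp f).integrable hq.out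
    have hg : Integrable g (ballMeasure p N) := (Lp.memLp g).integrable hq.out
    simp only [ballConv, Pi.add_apply]
    rw [← integral_add (integrable_ballConv N α t hf x) (integrable_ballConv N α t hg x)]
    refine integral_congr_ae ?_
    filter_upwards [Lp.coeFn_add f g] with y hy
    rw [hy, Pi.add_apply, mul_add]
  map_smul' c f := by
    rw [RingHom.id_apply, ← MemLp.toLp_const_smul]
    refine MemLp.toLp_congr _ _ (Eventually.of_forall fun x => ?_)
    simp only [ballConv, Pi.smul_apply, smul_eq_mul]
    rw [← integral_const_mul]
    refine integral_congr_ae ?_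
    filter_upwards [Lp.coeFn_smul c f] with y hy
    rw [hy, Pi.smul_apply, smul_eq_mul]
    ring

variable (p) in
/-- The operator `A_q^{(α)}` on `L^q(B_N)`: the generator of the semigroup `T_N^{(α)}`, with the
sign convention `T_N^{(α)} (t) = exp (-t A_q^{(α)})`. -/
def generatorA (N : ℤ) (α : ℝ) (q : ℝ≥0∞) [Fact (1 ≤ q)] : LqBall p N q →ₗ.[ℂ] LqBall p N q :=
  semigroupGenerator (ballSemigroup p N α q)

/-! ### Test functions on the ball -/

variable (p) in
/-- The space `D(B_N)` of locally constant functions on `ℚ_p` with support in `B_N`, identified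
with the space of all locally constant functions on the open and compact set `B_N`. -/
def testFunctions (N : ℤ) : Set (ℚ_[p] → ℂ) :=
  {φ | IsLocallyConstant φ ∧ Function.support φ ⊆ ball p N}

lemma memLp_of_mem_testFunctions {N : ℤ} {φ : ℚ_[p] → ℂ} (hφ : φ ∈ testFunctions p N)
    (q : ℝ≥0∞) : MemLp φ q (ballMeasure p N) :=
  hφ.1.continuous.memLp_of_hasCompactSupport
    (HasCompactSupport.intro (isCompact_ball p N) fun x hx => by
      by_contra h
      exact hx (hφ.2 h))

end Vladimirov

end

/-!
The two halves of the statement rest on different mechanisms.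

*The generator on test functions.* A test function `φ` on `B_N` is invariant under a small ball,
so its Fourier transform has compact support (`fourier_eq_zero`), and Fourier inversion holds
because the inversion integral, cut off at radius `p ^ m`, is the average of `φ` over a ball of
radius `p ^ (-m)` (`fourierInv_fourier`). By Fubini,
`T(t) φ = e^{λ t} F⁻¹[exp (-t |ξ|^α) F φ] + c(t) ∫ φ` (`ballConv_of_mem_testFunctions`).
Compactness of the support of `F φ` gives `F⁻¹[exp (-t |ξ|^α) F φ] = φ - t D^α φ + O(t²)` uniformly
in `x`, while `c(0) = c'(0) = 0` (`cCoeff_zero`, `hasDerivAt_cCoeff_zero`): only the first two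
coefficients of the power series in the definition of `c` matter, and `λ_α` is chosen to cancel
them. Hence `t⁻¹ (φ - T(t) φ) → D^α φ - λ_α φ` uniformly
(`exists_tendsto_norm_ballConv_sub_le`), and so in `L^q(B_N)`.

*Density in the graph norm.* The average `E_m u` of `u` over balls of radius `p ^ (-m)` is a test
function. Being a convolution over the abelian group `B_N`, the operator `E_m` commutes with `T(t)`
(`ballSemigroup_ballAverage`), and it is a contraction of `L^q(B_N)` by Jensen's inequality; hence
it preserves the domain of the generator `A`, and `A E_m u = E_m A u`
(`generatorA_ballAverage`). As `E_m → 1` strongly (`exists_norm_ballAverage_sub_lt`), both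
`E_m u → u` and `A E_m u → A u`.
-/

/-! ### Balls and their volumes -/

namespace Vladimirov

variable {p : ℕ} [Fact p.Prime]

lemma one_lt_natCast_prime : (1 : ℝ) < p := by exact_mod_cast (Fact.out : p.Prime).one_lt

lemma mem_ball {N : ℤ} {x : ℚ_[p]} : x ∈ ball p N ↔ ‖x‖ ≤ (p : ℝ) ^ N := Iff.rfl

lemma sub_mem_ball {N : ℤ} {x y : ℚ_[p]} (hx : x ∈ ball p N) (hy : y ∈ ball p N) :
    x - y ∈ ball p N := by
  rw [mem_ball, sub_eq_add_neg]
  exact (Padic.nonarchimedean _ _).trans (max_le hx (by rw [norm_neg]; exact hy))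

lemma neg_mem_ball {N : ℤ} {x : ℚ_[p]} : -x ∈ ball p N ↔ x ∈ ball p N := by
  rw [mem_ball, norm_neg, mem_ball]

lemma add_mem_ball {N : ℤ} {x y : ℚ_[p]} (hx : x ∈ ball p N) (hy : y ∈ ball p N) :
    x + y ∈ ball p N := by
  simpa using sub_mem_ball hx (neg_mem_ball.2 hy)

lemma ball_mono {M N : ℤ} (h : M ≤ N) : ball p M ⊆ ball p N := fun _ hx =>
  hx.trans (zpow_le_zpow_right₀ one_lt_natCast_prime.le h)

lemma measurableSet_ball (N : ℤ) : MeasurableSet (ball p N) := (isCompact_ball p N).measurableSet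

lemma norm_prime_zpow (k : ℤ) : ‖(p : ℚ_[p]) ^ k‖ = (p : ℝ) ^ (-k) := by
  rw [norm_zpow, Padic.norm_p, inv_zpow']

lemma mul_prime_zpow_mem_ball {k l : ℤ} {x : ℚ_[p]} :
    x * (p : ℚ_[p]) ^ k ∈ ball p (l - k) ↔ x ∈ ball p l := by
  have hp : (0 : ℝ) < p := one_pos.trans one_lt_natCast_prime
  rw [mem_ball, mem_ball, norm_mul, norm_prime_zpow, sub_eq_add_neg, zpow_add₀ hp.ne']
  exact mul_le_mul_iff_left₀ (zpow_pos hp _)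

/-- The ball of radius `p ^ k` is the disjoint union of the `p` translates, by digits times
`p ^ (-k)`, of the ball of radius `p ^ (k - 1)`. -/
lemma ball_eq_biUnion (k : ℤ) :
    ball p k = ⋃ a ∈ Finset.range p,
      (fun x : ℚ_[p] => x + -((a : ℚ_[p]) * (p : ℚ_[p]) ^ (-k))) ⁻¹' ball p (k - 1) := by
  have hp : (p : ℚ_[p]) ≠ 0 := by exact_mod_cast (Fact.out : p.Prime).ne_zero
  ext x
  simp only [Set.mem_iUnion, Set.mem_preimage, Finset.mem_range, exists_prop]
  constructor
  · intro hx
    have h1 : ‖x * (p : ℚ_[p]) ^ k‖ ≤ 1 := by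
      simpa [mem_ball] using (mul_prime_zpow_mem_ball (k := k)).2 hx
    obtain ⟨z, hz⟩ : ∃ z : ℤ_[p], (z : ℚ_[p]) = x * (p : ℚ_[p]) ^ k := ⟨⟨_, h1⟩, rfl⟩
    obtain ⟨a, ha, h⟩ := PadicInt.exists_mem_range z
    refine ⟨a, ha, ?_⟩
    rw [PadicInt.maximalIdeal_eq_span_p, Ideal.mem_span_singleton, ← PadicInt.norm_lt_one_iff_dvd,
      PadicInt.norm_def, PadicInt.coe_sub, PadicInt.coe_natCast, hz] at h
    have h2 := (Padic.norm_lt_pow_iff_norm_le_pow_sub_one (p := p) _ 0).1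
      (by rw [zpow_zero]; exact h)
    rw [← mul_prime_zpow_mem_ball (k := k), mem_ball]
    convert h2 using 2
    · rw [add_mul, neg_mul, mul_assoc, ← zpow_add₀ hp]
      simp [sub_eq_add_neg]
    · ring
  · rintro ⟨a, -, h⟩
    have h2 : (a : ℚ_[p]) * (p : ℚ_[p]) ^ (-k) ∈ ball p k := by
      have := (mul_prime_zpow_mem_ball (p := p) (k := -k) (l := 0) (x := a)).2
        (by simpa [mem_ball] using Padic.norm_int_le_one (p := p) a)
      simpa using this
    simpa using add_mem_ball (ball_mono (by omega) h) h2

lemma pairwiseDisjoint_ball_digits (k : ℤ) :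
    Set.PairwiseDisjoint (Finset.range p : Set ℕ)
      (fun a : ℕ => (fun x : ℚ_[p] => x + -((a : ℚ_[p]) * (p : ℚ_[p]) ^ (-k))) ⁻¹'
        ball p (k - 1)) := by
  intro a ha b hb hab
  refine Set.disjoint_left.2 fun x hxa hxb => hab ?_
  have h := sub_mem_ball hxb hxa
  have e : x + -((b : ℚ_[p]) * (p : ℚ_[p]) ^ (-k)) - (x + -((a : ℚ_[p]) * (p : ℚ_[p]) ^ (-k)))
      = ((a - b : ℤ) : ℚ_[p]) * (p : ℚ_[p]) ^ (-k) := by push_cast; ring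
  rw [e, show k - 1 = -1 - (-k) by ring, mul_prime_zpow_mem_ball, mem_ball] at h
  have h' := (Padic.norm_int_le_pow_iff_dvd (p := p) (a - b : ℤ) 1).1 (by simpa using h)
  rw [pow_one] at h'
  simp only [Finset.coe_range, Set.mem_Iio] at ha hb
  have := Int.eq_zero_of_abs_lt_dvd h' (by rw [abs_lt]; omega)
  omega

lemma haar_ball_eq_prime_mul (k : ℤ) : haar p (ball p k) = p * haar p (ball p (k - 1)) := by
  conv_lhs => rw [ball_eq_biUnion k]
  rw [measure_biUnion_finset (pairwiseDisjoint_ball_digits k)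
    fun a _ => (measurableSet_ball _).preimage (by fun_prop)]
  simp [measure_preimage_add_right]

lemma haar_ball_zero : haar p (ball p 0) = 1 := by
  have : ball p 0 = Metric.closedBall (0 : ℚ_[p]) 1 := by simp [ball_eq]
  rw [this]
  exact Measure.addHaarMeasure_self

lemma haarReal_ball (k : ℤ) : (haar p).real (ball p k) = (p : ℝ) ^ k := by
  have hp : (p : ℝ) ≠ 0 := (one_pos.trans one_lt_natCast_prime).ne'
  have hs : ∀ k : ℤ, (haar p).real (ball p k) = p * (haar p).real (ball p (k - 1)) := fun k => by
    simp [Measure.real, haar_ball_eq_prime_mul k]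
  induction k using Int.induction_on with
  | zero => simp [Measure.real, haar_ball_zero]
  | succ n ih => rw [hs, add_sub_cancel_right, ih, zpow_add_one₀ hp, mul_comm]
  | pred n ih =>
    rw [hs] at ih
    rw [zpow_sub_one₀ hp, ← ih]
    field_simp

lemma haar_ball_ne_top (k : ℤ) : haar p (ball p k) ≠ ∞ := (isCompact_ball p k).measure_ne_top

lemma haar_ball (k : ℤ) : haar p (ball p k) = ENNReal.ofReal ((p : ℝ) ^ k) := by
  rw [← haarReal_ball, ofReal_measureReal (haar_ball_ne_top k)]

/-! ### The additive character -/

lemma chi_eq_of_norm_sub_le {x y : ℚ_[p]} (h : ‖x - y‖ ≤ 1) : chi x = chi y := by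
  rw [chi, chi, fracPart_eq_of_norm_sub_le h]

lemma chi_eq_one_of_norm_le {x : ℚ_[p]} (h : ‖x‖ ≤ 1) : chi x = 1 := by
  have h0 : fracPart (0 : ℚ_[p]) = 0 := by simp [fracPart, PadicInt.appr]
  rw [chi_eq_of_norm_sub_le (y := 0) (by simpa using h), chi, h0]
  simp

lemma norm_le_one_of_chi_eq_one {x : ℚ_[p]} (h : chi x = 1) : ‖x‖ ≤ 1 := by
  obtain ⟨n, hn⟩ := Complex.exp_eq_one_iff.1 h
  have h2 : (2 * Real.pi * Complex.I : ℂ) ≠ 0 := Complex.two_pi_I_ne_zero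
  rw [mul_comm] at hn
  have h3 : (fracPart x : ℂ) = n := mul_right_cancel₀ h2 hn
  have h4 : fracPart x = n := by exact_mod_cast h3
  obtain ⟨h5, h6, -⟩ := fracPart_spec x
  rw [h4] at h5 h6
  have h7 : n = 0 := by
    have : 0 ≤ n := by exact_mod_cast h5
    have : n < 1 := by exact_mod_cast h6
    omega
  simpa [h4, h7] using norm_sub_fracPart_le x

/-- A rational number with `p`-power denominator that is a `p`-adic integer is an integer. -/
lemma exists_int_eq_of_norm_le_one {r : ℚ} {k : ℕ} {a : ℤ} (hr : r = a / (p : ℚ) ^ k)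
    (hn : ‖(r : ℚ_[p])‖ ≤ 1) : ∃ c : ℤ, r = c := by
  have hp : (p : ℚ) ≠ 0 := by exact_mod_cast (Fact.out : p.Prime).ne_zero
  have hp0 : (0 : ℝ) < p := one_pos.trans one_lt_natCast_prime
  have hdvd : ((p ^ k : ℕ) : ℤ) ∣ a := by
    have h : ‖(a : ℚ_[p])‖ ≤ (p : ℝ) ^ (-k : ℤ) := by
      rw [hr] at hn
      push_cast at hn
      rw [norm_div, norm_pow, Padic.norm_p, div_le_one (by positivity)] at hn
      rwa [zpow_neg, zpow_natCast, ← inv_pow]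
    exact_mod_cast (Padic.norm_int_le_pow_iff_dvd (p := p) a k).1 h
  obtain ⟨c, rfl⟩ := hdvd
  refine ⟨c, ?_⟩
  rw [hr]
  push_cast
  field_simp

lemma chi_add (x y : ℚ_[p]) : chi (x + y) = chi x * chi y := by
  obtain ⟨-, -, k, a, hx⟩ := fracPart_spec x
  obtain ⟨-, -, l, b, hy⟩ := fracPart_spec y
  obtain ⟨-, -, m, d, hz⟩ := fracPart_spec (x + y)
  have hp : (p : ℚ) ≠ 0 := by exact_mod_cast (Fact.out : p.Prime).ne_zero
  obtain ⟨c, hc⟩ := exists_int_eq_of_norm_le_one (p := p) (r := fracPart (x + y) - fracPart x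
      - fracPart y) (k := k + l + m) (a := d * p ^ (k + l) - a * p ^ (l + m) - b * p ^ (k + m))
    (by rw [hx, hy, hz]; push_cast; field_simp; ring) (by
      have e : ((fracPart (x + y) - fracPart x - fracPart y : ℚ) : ℚ_[p])
          = (x - fracPart x) - ((x + y - fracPart (x + y)) - (y - fracPart y)) := by
        push_cast; ring
      have hb : ∀ z : ℚ_[p], z - fracPart z ∈ ball p 0 := fun z => by
        simpa [mem_ball] using norm_sub_fracPart_le z
      rw [e]
      simpa [mem_ball] using sub_mem_ball (hb x) (sub_mem_ball (hb (x + y)) (hb y)))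
  have hf : (fracPart (x + y) : ℂ) = fracPart x + fracPart y + c := by
    have : fracPart (x + y) = fracPart x + fracPart y + c := by linarith
    rw [this]
    push_cast
    rfl
  rw [chi, chi, chi, hf, ← Complex.exp_add]
  refine Complex.exp_eq_exp_iff_exists_int.2 ⟨c, ?_⟩
  ring

/-- Two `p`-adic numbers, one in the ball of radius `p ^ k` and the other in the dual ball, have
an integral product. -/
lemma norm_mul_le_one_of_mem_ball {k : ℤ} {x ξ : ℚ_[p]} (hx : x ∈ ball p (-k))
    (hξ : ξ ∈ ball p k) : ‖x * ξ‖ ≤ 1 := by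
  have hp : (0 : ℝ) < p := one_pos.trans one_lt_natCast_prime
  rw [norm_mul]
  calc ‖x‖ * ‖ξ‖ ≤ (p : ℝ) ^ (-k) * (p : ℝ) ^ k := mul_le_mul hx hξ (norm_nonneg _) (by positivity)
    _ = 1 := by rw [← zpow_add₀ hp.ne']; simp

lemma chi_prime_zpow_mul_ne_one {k : ℤ} {ξ : ℚ_[p]} (hξ : ξ ∉ ball p k) :
    chi ((p : ℚ_[p]) ^ k * ξ) ≠ 1 := fun h => hξ <| by
  have := norm_le_one_of_chi_eq_one h
  rw [← mul_prime_zpow_mem_ball (k := k), mem_ball, mul_comm]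
  simpa using this

lemma prime_zpow_mem_ball (k : ℤ) : (p : ℚ_[p]) ^ k ∈ ball p (-k) := (norm_prime_zpow k).le

lemma integrable_chi_mul {f : ℚ_[p] → ℂ} (hf : Integrable f (haar p)) {g : ℚ_[p] → ℚ_[p]}
    (hg : Continuous g) : Integrable (fun x => chi (g x) * f x) (haar p) :=
  hf.bdd_mul (c := 1) (continuous_chi.comp hg).aestronglyMeasurable
    (Eventually.of_forall fun _ => (norm_chi _).le)

/-- The Fourier transform of a function invariant under translations by the elements of the ball
of radius `p ^ (-m)` is supported in the ball of radius `p ^ m`. -/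
lemma fourier_eq_zero {f : ℚ_[p] → ℂ} {m : ℤ} (hf : ∀ x, ∀ h ∈ ball p (-m), f (x + h) = f x)
    {ξ : ℚ_[p]} (hξ : ξ ∉ ball p m) : fourier f ξ = 0 := by
  have h : fourier f ξ = chi ((p : ℚ_[p]) ^ m * ξ) * fourier f ξ := by
    conv_lhs => rw [fourier, ← integral_add_right_eq_self _ ((p : ℚ_[p]) ^ m)]
    rw [fourier, ← integral_const_mul]
    refine integral_congr_ae (Eventually.of_forall fun x => ?_)
    simp only [hf x _ (prime_zpow_mem_ball m), add_mul, chi_add]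
    ring
  by_contra h0
  exact chi_prime_zpow_mul_ne_one hξ (mul_right_cancel₀ h0 (by rw [one_mul]; exact h.symm))

/-- The Fourier transform of the indicator function of a ball. -/
lemma setIntegral_chi_mul (k : ℤ) (ξ : ℚ_[p]) :
    ∫ x in ball p k, chi (x * ξ) ∂haar p
      = (ball p (-k)).indicator (fun _ => ((p : ℝ) ^ k : ℂ)) ξ := by
  by_cases hξ : ξ ∈ ball p (-k)
  · rw [Set.indicator_of_mem hξ, setIntegral_congr_fun (g := fun _ => (1 : ℂ))
      (measurableSet_ball k) fun x hx => chi_eq_one_of_norm_le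
        (by rw [mul_comm]; exact norm_mul_le_one_of_mem_ball hξ hx)]
    simp [haarReal_ball]
  · rw [Set.indicator_of_notMem hξ]
    have h := fourier_eq_zero (f := (ball p k).indicator 1) (m := -k) (fun x h hh => ?_) hξ
    · rw [← h, fourier, ← integral_indicator (measurableSet_ball k)]
      refine integral_congr_ae (Eventually.of_forall fun x => ?_)
      by_cases hx : x ∈ ball p k <;> simp [hx]
    · rw [neg_neg] at hh
      by_cases hx : x ∈ ball p k
      · rw [Set.indicator_of_mem hx, Set.indicator_of_mem (add_mem_ball hx hh)]; rfl
      · rw [Set.indicator_of_notMem hx, Set.indicator_of_notMem fun h' => hx ?_]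
        simpa using sub_mem_ball h' hh

end Vladimirov

/-! ### Fourier analysis of test functions -/

namespace Vladimirov

variable {p : ℕ} [Fact p.Prime]

lemma continuous_fourier {f : ℚ_[p] → ℂ} (hf : Integrable f (haar p)) :
    Continuous (fourier f) := by
  refine continuous_of_dominated (bound := fun x => ‖f x‖)
    (fun ξ => (integrable_chi_mul hf (by fun_prop)).1)
    (fun ξ => Eventually.of_forall fun x => ?_) hf.norm (Eventually.of_forall fun x => ?_)
  · rw [norm_mul, norm_chi, one_mul]
  · exact (continuous_chi.comp (by fun_prop)).mul continuous_const

lemma continuous_fourierInv {g : ℚ_[p] → ℂ} (hg : Integrable g (haar p)) :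
    Continuous (fourierInv g) := by
  refine continuous_of_dominated (bound := fun x => ‖g x‖)
    (fun ξ => (integrable_chi_mul hg (by fun_prop)).1)
    (fun ξ => Eventually.of_forall fun x => ?_) hg.norm (Eventually.of_forall fun x => ?_)
  · rw [norm_mul, norm_chi, one_mul]
  · exact (continuous_chi.comp (by fun_prop)).mul continuous_const

lemma norm_fourierInv_le (g : ℚ_[p] → ℂ) (x : ℚ_[p]) :
    ‖fourierInv g x‖ ≤ ∫ ξ, ‖g ξ‖ ∂haar p := by
  refine (norm_integral_le_integral_norm _).trans (le_of_eq ?_)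
  simp [norm_chi]

lemma add_notMem_ball {N : ℤ} {x h : ℚ_[p]} (hx : x ∉ ball p N) (hh : h ∈ ball p N) :
    x + h ∉ ball p N := fun h' => hx <| by simpa using sub_mem_ball h' hh

lemma exists_ball_neg_lt {δ : ℝ} (hδ : 0 < δ) (N : ℤ) :
    ∃ m : ℤ, -m ≤ N ∧ (p : ℝ) ^ (-m) < δ := by
  have h1 : (p : ℝ)⁻¹ < 1 := inv_lt_one_of_one_lt₀ one_lt_natCast_prime
  have h0 : 0 < (p : ℝ)⁻¹ := inv_pos.2 (one_pos.trans one_lt_natCast_prime)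
  obtain ⟨n, hn⟩ := exists_pow_lt_of_lt_one hδ h1
  refine ⟨max n (-N), by omega, lt_of_le_of_lt ?_ hn⟩
  rw [inv_pow, ← zpow_natCast, ← zpow_neg]
  exact zpow_le_zpow_right₀ one_lt_natCast_prime.le (by omega)

/-- A test function is invariant under translations by the elements of a small ball. -/
lemma exists_forall_add_eq {N : ℤ} {φ : ℚ_[p] → ℂ} (hφ : φ ∈ testFunctions p N) :
    ∃ m : ℤ, ∀ x, ∀ h ∈ ball p (-m), φ (x + h) = φ x := by
  obtain ⟨δ, hδ, H⟩ := lebesgue_number_lemma_of_metric (c := fun z : ℂ => φ ⁻¹' {z})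
    (isCompact_ball p N) (fun z => hφ.1 {z}) (fun x _ => Set.mem_iUnion.2 ⟨φ x, rfl⟩)
  obtain ⟨m, hm, hmδ⟩ := exists_ball_neg_lt (p := p) hδ N
  refine ⟨m, fun x h hh => ?_⟩
  by_cases hx : x ∈ ball p N
  · obtain ⟨z, hz⟩ := H x hx
    have h1 : φ x = z := hz (Metric.mem_ball_self hδ)
    have h2 : φ (x + h) = z := hz (by simpa using lt_of_le_of_lt hh hmδ)
    rw [h1, h2]
  · have h0 : ∀ y, y ∉ ball p N → φ y = 0 := fun y hy => by
      by_contra h'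
      exact hy (hφ.2 h')
    rw [h0 x hx, h0 _ (add_notMem_ball hx (ball_mono hm hh))]

lemma hasCompactSupport_of_mem_testFunctions {N : ℤ} {φ : ℚ_[p] → ℂ}
    (hφ : φ ∈ testFunctions p N) : HasCompactSupport φ :=
  HasCompactSupport.intro (isCompact_ball p N) fun x hx => by
    by_contra h
    exact hx (hφ.2 h)

lemma integrable_of_mem_testFunctions {N : ℤ} {φ : ℚ_[p] → ℂ} (hφ : φ ∈ testFunctions p N) :
    Integrable φ (haar p) :=
  hφ.1.continuous.integrable_of_hasCompactSupport (hasCompactSupport_of_mem_testFunctions hφ)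

lemma integrable_continuous_mul_fourier {N : ℤ} {φ : ℚ_[p] → ℂ} (hφ : φ ∈ testFunctions p N)
    {w : ℚ_[p] → ℂ} (hw : Continuous w) : Integrable (fun ξ => w ξ * fourier φ ξ) (haar p) := by
  obtain ⟨m, hm⟩ := exists_forall_add_eq hφ
  refine (hw.mul (continuous_fourier (integrable_of_mem_testFunctions hφ))
    ).integrable_of_hasCompactSupport (HasCompactSupport.intro (isCompact_ball p m) fun ξ hξ => ?_)
  simp [fourier_eq_zero hm hξ]

/-- Fourier inversion for test functions. If `φ` is invariant under the ball of radius `p ^ (-m)`,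
then cutting the inversion integral off at radius `p ^ m` averages `φ` over that ball. -/
lemma fourierInv_fourier {N : ℤ} {φ : ℚ_[p] → ℂ} (hφ : φ ∈ testFunctions p N) (x : ℚ_[p]) :
    fourierInv (fourier φ) x = φ x := by
  obtain ⟨m, hm⟩ := exists_forall_add_eq hφ
  have hp : (p : ℝ) ≠ 0 := (one_pos.trans one_lt_natCast_prime).ne'
  have hi := integrable_of_mem_testFunctions hφ
  have hF : Integrable (Function.uncurry fun ξ y : ℚ_[p] => chi (-(x * ξ)) * (chi (y * ξ) * φ y))
      ((ballMeasure p m).prod (haar p)) := by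
    have h1 : Integrable (fun z : ℚ_[p] × ℚ_[p] => φ z.2) ((ballMeasure p m).prod (haar p)) :=
      hi.comp_snd _
    refine ((h1.bdd_mul (c := 1) (f := fun z : ℚ_[p] × ℚ_[p] => chi (z.2 * z.1)) ?_ ?_).bdd_mul
      (c := 1) (f := fun z : ℚ_[p] × ℚ_[p] => chi (-(x * z.1))) ?_ ?_)
    · exact (continuous_chi.comp (by fun_prop)).aestronglyMeasurable
    · exact Eventually.of_forall fun _ => (norm_chi _).le
    · exact (continuous_chi.comp (by fun_prop)).aestronglyMeasurable
    · exact Eventually.of_forall fun _ => (norm_chi _).le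
  calc fourierInv (fourier φ) x
      = ∫ ξ, chi (-(x * ξ)) * fourier φ ξ ∂(ballMeasure p m) := by
        refine (setIntegral_eq_integral_of_forall_compl_eq_zero fun ξ hξ => ?_).symm
        rw [fourier_eq_zero hm hξ, mul_zero]
    _ = ∫ ξ, ∫ y, chi (-(x * ξ)) * (chi (y * ξ) * φ y) ∂(haar p) ∂(ballMeasure p m) := by
        simp only [fourier, integral_const_mul]
    _ = ∫ y, ∫ ξ, chi (-(x * ξ)) * (chi (y * ξ) * φ y) ∂(ballMeasure p m) ∂(haar p) :=
        integral_integral_swap hF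
    _ = ∫ y, (ball p (-m)).indicator (fun _ => ((p : ℝ) ^ m : ℂ)) (y - x) * φ y ∂(haar p) := by
        refine integral_congr_ae (Eventually.of_forall fun y => ?_)
        simp only [← setIntegral_chi_mul]
        rw [← integral_mul_const]
        refine integral_congr_ae (Eventually.of_forall fun ξ => ?_)
        simp only
        rw [← mul_assoc, ← chi_add]
        congr 2
        ring
    _ = ∫ h, (ball p (-m)).indicator (fun _ => ((p : ℝ) ^ m : ℂ)) h * φ (x + h) ∂(haar p) := by
        rw [← integral_add_left_eq_self _ x]
        simp
    _ = ∫ h, (ball p (-m)).indicator (fun _ => ((p : ℝ) ^ m : ℂ) * φ x) h ∂(haar p) := by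
        refine integral_congr_ae (Eventually.of_forall fun h => ?_)
        by_cases hh : h ∈ ball p (-m)
        · simp [hh, hm x h hh]
        · simp [hh]
    _ = φ x := by
        rw [integral_indicator (measurableSet_ball _), setIntegral_const, haarReal_ball,
          Complex.real_smul, ← mul_assoc]
        have : (((p : ℝ) ^ (-m) : ℝ) : ℂ) * ((p : ℝ) ^ m : ℂ) = 1 := by
          rw [← Complex.ofReal_zpow, ← Complex.ofReal_mul, ← zpow_add₀ hp]
          simp
        rw [this, one_mul]

/-! ### The heat semigroup on test functions -/

lemma exists_exp_neg_mul_rpow_le {α t : ℝ} (hα : 0 < α) (ht : 0 < t) :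
    ∃ C : ℝ, 0 ≤ C ∧ ∀ s : ℝ, 0 ≤ s → Real.exp (-t * s ^ α) * (1 + s) ^ 2 ≤ C := by
  obtain ⟨n, hn⟩ := exists_nat_ge (2 / α)
  rw [div_le_iff₀ hα] at hn
  refine ⟨4 * (1 + n.factorial / t ^ n), by positivity, fun s hs => ?_⟩
  have h1 : (1 + s) ^ 2 ≤ 4 * (1 + (s ^ α) ^ n) := by
    rcases le_total s 1 with h | h
    · have : 0 ≤ (s ^ α) ^ n := by positivity
      nlinarith
    · have h2 : s ^ 2 ≤ (s ^ α) ^ n := by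
        rw [← Real.rpow_natCast, ← Real.rpow_natCast, ← Real.rpow_mul hs]
        exact Real.rpow_le_rpow_of_exponent_le h (by push_cast; linarith)
      nlinarith
  have hy : 0 ≤ s ^ α := by positivity
  generalize s ^ α = y at h1 hy
  have h3 : Real.exp (-t * y) * y ^ n ≤ n.factorial / t ^ n := by
    have h4 := Real.pow_div_factorial_le_exp (t * y) (by positivity) n
    rw [div_le_iff₀ (by positivity), mul_pow] at h4
    rw [neg_mul, Real.exp_neg, le_div_iff₀ (by positivity), inv_mul_eq_div, div_mul_eq_mul_div,
      div_le_iff₀ (Real.exp_pos _)]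
    linarith
  have h5 : Real.exp (-t * y) ≤ 1 := Real.exp_le_one_iff.2 (by nlinarith)
  calc Real.exp (-t * y) * (1 + s) ^ 2 ≤ Real.exp (-t * y) * (4 * (1 + y ^ n)) := by gcongr
    _ ≤ _ := by nlinarith

/-- The function `exp (-t |ξ|_p ^ α)` is integrable: it is bounded by a multiple of
`∑ₖ p ^ (-2 k) 1_{B_k}`. -/
lemma integrable_exp_neg_mul_norm_rpow {α t : ℝ} (hα : 0 < α) (ht : 0 < t) :
    Integrable (fun ξ : ℚ_[p] => Real.exp (-t * ‖ξ‖ ^ α)) (haar p) := by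
  have hp1 : (1 : ℝ) < p := one_lt_natCast_prime
  have hp : (0 : ℝ) < p := one_pos.trans hp1
  obtain ⟨C, hC0, hC⟩ := exists_exp_neg_mul_rpow_le hα ht
  have hmeas : Measurable fun ξ : ℚ_[p] => Real.exp (-t * ‖ξ‖ ^ α) := by fun_prop
  refine ⟨hmeas.aestronglyMeasurable, ?_⟩
  -- A point of norm `s` lies in some `B_k` with `p ^ k ≤ p (1 + s)`, where the bound `C / (1 + s) ^ 2`
  -- is at most `c k`; the mass `c k * p ^ k` of the `k`-th term is summable.
  set c : ℕ → ℝ := fun k => C * p ^ 2 / (p ^ k) ^ 2 with hc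
  have hle : ∀ ξ : ℚ_[p], ‖Real.exp (-t * ‖ξ‖ ^ α)‖ₑ
      ≤ ∑' k : ℕ, (ball p k).indicator (fun _ => ENNReal.ofReal (c k)) ξ := fun ξ => by
    obtain ⟨n, hn1, hn2⟩ := exists_nat_pow_near (x := 1 + ‖ξ‖) (by simp) hp1
    refine le_trans ?_ (ENNReal.le_tsum (n + 1))
    have hξ : ξ ∈ ball p ((n + 1 : ℕ) : ℤ) := by
      rw [mem_ball, zpow_natCast]
      linarith
    rw [Set.indicator_of_mem hξ, Real.enorm_eq_ofReal (Real.exp_nonneg _)]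
    refine ENNReal.ofReal_le_ofReal ?_
    rw [hc, le_div_iff₀ (by positivity)]
    calc Real.exp (-t * ‖ξ‖ ^ α) * ((p : ℝ) ^ (n + 1)) ^ 2
        ≤ Real.exp (-t * ‖ξ‖ ^ α) * (p * (1 + ‖ξ‖)) ^ 2 := by
          rw [pow_succ' (p : ℝ) n]
          gcongr
      _ = (Real.exp (-t * ‖ξ‖ ^ α) * (1 + ‖ξ‖) ^ 2) * p ^ 2 := by ring
      _ ≤ C * p ^ 2 := by
          gcongr
          exact hC _ (norm_nonneg _)
  refine (lintegral_mono hle).trans_lt ?_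
  rw [lintegral_tsum fun k => (measurable_const.indicator (measurableSet_ball _)).aemeasurable]
  have hsum : Summable fun k : ℕ => C * p ^ 2 * ((p : ℝ)⁻¹) ^ k :=
    (summable_geometric_of_lt_one (by positivity) (inv_lt_one_of_one_lt₀ hp1)).mul_left _
  have : ∀ k : ℕ, ∫⁻ ξ, (ball p k).indicator (fun _ => ENNReal.ofReal (c k)) ξ ∂haar p
      = ENNReal.ofReal (C * p ^ 2 * ((p : ℝ)⁻¹) ^ k) := fun k => by
    rw [lintegral_indicator_const (measurableSet_ball _), haar_ball,
      ← ENNReal.ofReal_mul (by positivity), zpow_natCast, hc]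
    congr 1
    simp only [inv_pow]
    field_simp
  simp_rw [this]
  exact hsum.tsum_ofReal_lt_top

lemma integral_heatKernel_mul {α t : ℝ} (hα : 0 < α) (ht : 0 < t) {φ : ℚ_[p] → ℂ}
    (hφ : Integrable φ (haar p)) (x : ℚ_[p]) :
    ∫ y, heatKernel α t (x - y) * φ y ∂haar p
      = fourierInv (fun ξ => (Real.exp (-t * ‖ξ‖ ^ α) : ℂ) * fourier φ ξ) x := by
  have he := integrable_exp_neg_mul_norm_rpow (p := p) hα ht
  have hF : Integrable (Function.uncurry fun y ξ : ℚ_[p] =>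
      chi (ξ * (x - y)) * ((Real.exp (-t * ‖ξ‖ ^ α) : ℂ)) * φ y) ((haar p).prod (haar p)) := by
    have h1 := (hφ.mul_prod (ν := haar p) he.ofReal).bdd_mul (c := 1)
      (f := fun z : ℚ_[p] × ℚ_[p] => chi (z.2 * (x - z.1)))
      (continuous_chi.comp (by fun_prop)).aestronglyMeasurable
      (Eventually.of_forall fun _ => (norm_chi _).le)
    refine h1.congr (Eventually.of_forall fun z => ?_)
    simp only [Function.uncurry]
    rw [mul_assoc, mul_comm (φ z.1)]
    rfl
  calc ∫ y, heatKernel α t (x - y) * φ y ∂haar p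
      = ∫ y, ∫ ξ, chi (ξ * (x - y)) * (Real.exp (-t * ‖ξ‖ ^ α) : ℂ) * φ y ∂haar p ∂haar p := by
        simp only [heatKernel, integral_mul_const]
    _ = ∫ ξ, ∫ y, chi (ξ * (x - y)) * (Real.exp (-t * ‖ξ‖ ^ α) : ℂ) * φ y ∂haar p ∂haar p :=
        integral_integral_swap hF
    _ = ∫ ξ, (∫ y, chi (-ξ * (x - y)) * (Real.exp (-t * ‖-ξ‖ ^ α) : ℂ) * φ y ∂haar p) ∂haar p :=
        (integral_neg_eq_self (fun ξ => ∫ y, chi (ξ * (x - y)) *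
          (Real.exp (-t * ‖ξ‖ ^ α) : ℂ) * φ y ∂haar p) (haar p)).symm
    _ = _ := by
        refine integral_congr_ae (Eventually.of_forall fun ξ => ?_)
        simp only [fourier, norm_neg]
        rw [← mul_assoc, ← integral_const_mul]
        refine integral_congr_ae (Eventually.of_forall fun y => ?_)
        simp only
        rw [show -ξ * (x - y) = -(x * ξ) + y * ξ by ring, chi_add]
        ring

lemma ballConv_of_mem_testFunctions {N : ℤ} {α t : ℝ} (hα : 0 < α) (ht : 0 < t) {φ : ℚ_[p] → ℂ}
    (hφ : φ ∈ testFunctions p N) (x : ℚ_[p]) :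
    ballConv N α t φ x = (Real.exp (lam p N α * t) : ℂ) *
        fourierInv (fun ξ => (Real.exp (-t * ‖ξ‖ ^ α) : ℂ) * fourier φ ξ) x
      + (cCoeff p N α t : ℂ) * ∫ y, φ y ∂ballMeasure p N := by
  have hi : Integrable φ (ballMeasure p N) := (integrable_of_mem_testFunctions hφ).restrict
  have h1 : ∫ y, heatKernel α t (x - y) * φ y ∂ballMeasure p N
      = ∫ y, heatKernel α t (x - y) * φ y ∂haar p := by
    refine setIntegral_eq_integral_of_forall_compl_eq_zero fun y hy => ?_
    have : φ y = 0 := by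
      by_contra h
      exact hy (hφ.2 h)
    rw [this, mul_zero]
  have h2 : Integrable (fun y => (cCoeff p N α t : ℂ) * φ y) (ballMeasure p N) := hi.const_mul _
  have h3 := integrable_ballConv N α t hi x
  rw [← integral_heatKernel_mul hα ht (integrable_of_mem_testFunctions hφ), ← h1,
    ← integral_const_mul, ← integral_const_mul, ← integral_add _ h2]
  · refine integral_congr_ae (Eventually.of_forall fun y => ?_)
    simp only [ballHeatKernel]
    ring
  · refine (h3.sub h2).congr (Eventually.of_forall fun y => ?_)
    simp only [ballHeatKernel, Pi.sub_apply]
    ring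

end Vladimirov

/-! ### Behaviour of the kernel as `t → 0+` -/

lemma hasDerivAt_tsum_mul_pow_zero {a : ℕ → ℝ} (ha : Summable fun n => |a n|) :
    HasDerivAt (fun t : ℝ => ∑' n, a n * t ^ n) (a 1) 0 := by
  have hsum : ∀ t : ℝ, |t| ≤ 1 → Summable fun n => a n * t ^ n := fun t ht =>
    Summable.of_norm_bounded ha fun n => by
      rw [Real.norm_eq_abs, abs_mul, abs_pow]
      exact mul_le_of_le_one_right (abs_nonneg _) (pow_le_one₀ (abs_nonneg _) ht)
  have ha2 : Summable fun n => |a (n + 2)| := (summable_nat_add_iff 2).2 ha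
  rw [hasDerivAt_iff_isLittleO_nhds_zero]
  refine Asymptotics.IsBigO.trans_isLittleO (g := fun t : ℝ => t ^ 2) ?_
    (Asymptotics.isLittleO_pow_id one_lt_two)
  refine Asymptotics.IsBigO.of_bound (∑' n, |a (n + 2)|) ?_
  filter_upwards [Metric.closedBall_mem_nhds (0 : ℝ) one_pos] with t ht
  have ht : |t| ≤ 1 := by simpa using ht
  have hst : Summable fun n => a (n + 2) * t ^ n :=
    Summable.of_norm_bounded ha2 fun n => by
      rw [Real.norm_eq_abs, abs_mul, abs_pow]
      exact mul_le_of_le_one_right (abs_nonneg _) (pow_le_one₀ (abs_nonneg _) ht)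
  have h0 : ∑' n, a n * (0 : ℝ) ^ n = a 0 := by
    rw [tsum_eq_single 0 fun n hn => by simp [hn]]
    simp
  have ht2 : ∑' n, a n * t ^ n = a 0 + a 1 * t + t ^ 2 * ∑' n, a (n + 2) * t ^ n := by
    rw [← (hsum t ht).sum_add_tsum_nat_add 2, ← tsum_mul_left]
    congr 1
    · simp [Finset.sum_range_succ]
    · exact tsum_congr fun n => by ring
  have hle : |∑' n, a (n + 2) * t ^ n| ≤ ∑' n, |a (n + 2)| := by
    rw [← Real.norm_eq_abs]
    refine tsum_of_norm_bounded ha2.hasSum fun n => ?_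
    rw [Real.norm_eq_abs, abs_mul, abs_pow]
    exact mul_le_of_le_one_right (abs_nonneg _) (pow_le_one₀ (abs_nonneg _) ht)
  rw [zero_add, h0, ht2, smul_eq_mul, Real.norm_eq_abs, Real.norm_eq_abs, abs_pow,
    show a 0 + a 1 * t + t ^ 2 * ∑' n, a (n + 2) * t ^ n - a 0 - t * a 1
      = t ^ 2 * ∑' n, a (n + 2) * t ^ n by ring, abs_mul, abs_pow, mul_comm]
  gcongr

lemma abs_exp_neg_sub_one_add_le_sq {y : ℝ} (hy : 0 ≤ y) : |Real.exp (-y) - 1 + y| ≤ y ^ 2 := by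
  rcases le_total y 1 with h | h
  · simpa using Real.abs_exp_sub_one_sub_id_le (x := -y) (by rwa [abs_neg, abs_of_nonneg hy])
  · have h1 := Real.add_one_le_exp (-y)
    have h2 : Real.exp (-y) ≤ 1 := Real.exp_le_one_iff.2 (by linarith)
    rw [abs_of_nonneg (by linarith)]
    nlinarith

namespace Vladimirov

/-- The coefficients of the power series in the definition of `c(t)`. -/
noncomputable def cSeries (p : ℕ) (N : ℤ) (α : ℝ) (n : ℕ) : ℝ :=
  (-1 : ℝ) ^ n / (n.factorial : ℝ) * ((p : ℝ) ^ (-(N : ℝ) * α * n) / (1 - (p : ℝ) ^ (-α * n - 1)))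

lemma cCoeff_eq (p : ℕ) (N : ℤ) (α t : ℝ) :
    cCoeff p N α t = (p : ℝ) ^ (-N) - (p : ℝ) ^ (-N) * (1 - (p : ℝ)⁻¹) *
      Real.exp (lam p N α * t) * ∑' n, cSeries p N α n * t ^ n := by
  rw [cCoeff]
  congr 3
  ext n
  rw [cSeries]
  ring

variable {p : ℕ} [Fact p.Prime]

lemma summable_abs_cSeries (N : ℤ) {α : ℝ} (hα : 0 < α) :
    Summable fun n => |cSeries p N α n| := by
  have hp1 : (1 : ℝ) < p := one_lt_natCast_prime
  have hp : (0 : ℝ) < p := one_pos.trans hp1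
  have hd : 0 < 1 - (p : ℝ)⁻¹ := sub_pos.2 (inv_lt_one_of_one_lt₀ hp1)
  refine Summable.of_nonneg_of_le (fun n => abs_nonneg _) (fun n => ?_)
    ((Real.summable_pow_div_factorial ((p : ℝ) ^ (-(N : ℝ) * α))).mul_right (1 - (p : ℝ)⁻¹)⁻¹)
  have h1 : (p : ℝ) ^ (-α * n - 1) ≤ (p : ℝ)⁻¹ := by
    rw [← Real.rpow_neg_one]
    exact Real.rpow_le_rpow_of_exponent_le hp1.le (by nlinarith [n.cast_nonneg (α := ℝ)])
  have h2 : 0 < 1 - (p : ℝ) ^ (-α * n - 1) := by linarith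
  rw [cSeries, abs_mul, abs_div, abs_pow, abs_neg, abs_one, one_pow, abs_div, abs_of_pos h2,
    Nat.abs_cast, Real.rpow_mul_natCast hp.le, abs_of_nonneg (by positivity), one_div,
    div_eq_mul_inv, div_eq_mul_inv, ← mul_assoc]
  refine mul_le_mul (le_of_eq (mul_comm _ _)) ?_ (inv_nonneg.2 h2.le) (by positivity)
  exact inv_anti₀ hd (by linarith)

lemma one_sub_inv_mul_cSeries_zero (N : ℤ) (α : ℝ) :
    (1 - (p : ℝ)⁻¹) * cSeries p N α 0 = 1 := by
  have hd : 0 < 1 - (p : ℝ)⁻¹ := sub_pos.2 (inv_lt_one_of_one_lt₀ one_lt_natCast_prime)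
  simp [cSeries, Real.rpow_neg_one, hd.ne']

lemma one_sub_inv_mul_cSeries_one (N : ℤ) {α : ℝ} (hα : 0 < α) :
    (1 - (p : ℝ)⁻¹) * cSeries p N α 1 = -lam p N α := by
  have hp1 : (1 : ℝ) < p := one_lt_natCast_prime
  have hp : (0 : ℝ) < p := one_pos.trans hp1
  have h2 : (1 : ℝ) < (p : ℝ) ^ (α + 1) := Real.one_lt_rpow hp1 (by linarith)
  have e1 : (p : ℝ) ^ (-α * (1 : ℕ) - 1) = ((p : ℝ) ^ (α + 1))⁻¹ := by
    rw [← Real.rpow_neg hp.le]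
    congr 1
    push_cast
    ring
  have e2 : (p : ℝ) ^ (α * (1 - (N : ℝ))) = (p : ℝ) ^ (-(N : ℝ) * α * (1 : ℕ)) * (p : ℝ) ^ α := by
    rw [← Real.rpow_add hp]
    congr 1
    push_cast
    ring
  have e3 : (p : ℝ) ^ (α + 1) = (p : ℝ) ^ α * p := by rw [Real.rpow_add hp, Real.rpow_one]
  have h3 : (p : ℝ) ^ (α + 1) - 1 ≠ 0 := by linarith
  rw [cSeries, lam, e1, e2]
  rw [show 1 - ((p : ℝ) ^ (α + 1))⁻¹ = ((p : ℝ) ^ (α + 1) - 1) / (p : ℝ) ^ (α + 1) by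
    rw [sub_div, div_self (by positivity), one_div]]
  generalize (p : ℝ) ^ (-(N : ℝ) * α * (1 : ℕ)) = A
  rw [e3] at h3 ⊢
  have hpa : (p : ℝ) ^ α ≠ 0 := by positivity
  simp only [pow_one, Nat.factorial_one, Nat.cast_one]
  field_simp

/-- The function `c(t)` vanishes to second order at `t = 0`: this expresses that `λ_α` is the mean
of `|ξ|_p ^ α` over the dual ball of radius `p ^ (-N)`. -/
lemma hasDerivAt_cCoeff_zero (N : ℤ) {α : ℝ} (hα : 0 < α) :
    HasDerivAt (cCoeff p N α) 0 0 := by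
  have h1 := hasDerivAt_tsum_mul_pow_zero (summable_abs_cSeries (p := p) N hα)
  have h2 : HasDerivAt (fun t : ℝ => Real.exp (lam p N α * t)) (lam p N α) 0 := by
    simpa using ((hasDerivAt_id (0 : ℝ)).const_mul (lam p N α)).exp
  have h3 := ((h2.mul h1).const_mul ((p : ℝ) ^ (-N) * (1 - (p : ℝ)⁻¹))).const_sub ((p : ℝ) ^ (-N))
  have h0 : ∑' n, cSeries p N α n * (0 : ℝ) ^ n = cSeries p N α 0 := by
    rw [tsum_eq_single 0 fun n hn => by simp [hn]]
    simp
  have hf : cCoeff p N α = fun t => (p : ℝ) ^ (-N) - (p : ℝ) ^ (-N) * (1 - (p : ℝ)⁻¹) *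
      (Real.exp (lam p N α * t) * ∑' n, cSeries p N α n * t ^ n) := by
    ext t
    rw [cCoeff_eq, mul_assoc]
  rw [hf]
  refine HasDerivAt.congr_deriv h3 ?_
  rw [h0]
  simp only [mul_zero, Real.exp_zero, one_mul]
  have e0 := one_sub_inv_mul_cSeries_zero (p := p) N α
  have e1 := one_sub_inv_mul_cSeries_one (p := p) N hα
  linear_combination -(p : ℝ) ^ (-N) * lam p N α * e0 - (p : ℝ) ^ (-N) * e1

lemma cCoeff_zero (N : ℤ) (α : ℝ) : cCoeff p N α 0 = 0 := by
  have h0 : ∑' n, cSeries p N α n * (0 : ℝ) ^ n = cSeries p N α 0 := by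
    rw [tsum_eq_single 0 fun n hn => by simp [hn]]
    simp
  rw [cCoeff_eq, h0, mul_zero, Real.exp_zero, mul_one, mul_assoc, one_sub_inv_mul_cSeries_zero]
  ring

lemma integrable_fourierInv_multiplier {N : ℤ} {φ : ℚ_[p] → ℂ} (hφ : φ ∈ testFunctions p N)
    {w : ℚ_[p] → ℝ} (hw : Continuous w) :
    Integrable (fun ξ => (w ξ : ℂ) * fourier φ ξ) (haar p) :=
  integrable_continuous_mul_fourier hφ (Complex.continuous_ofReal.comp hw)

/-- Second order expansion of `F⁻¹ (exp (-t |ξ|_p ^ α) F φ)` as `t → 0+`, uniform in the space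
variable because `F φ` has compact support. -/
lemma exists_norm_fourierInv_exp_sub_le {N : ℤ} {α : ℝ} (hα : 0 < α) {φ : ℚ_[p] → ℂ}
    (hφ : φ ∈ testFunctions p N) :
    ∃ K : ℝ, ∀ t : ℝ, 0 < t → ∀ x,
      ‖fourierInv (fun ξ => (Real.exp (-t * ‖ξ‖ ^ α) : ℂ) * fourier φ ξ) x
        - φ x + t * vladimirov α φ x‖ ≤ K * t ^ 2 := by
  have hc : Continuous fun ξ : ℚ_[p] => ‖ξ‖ ^ α :=
    continuous_norm.rpow_const fun _ => Or.inr hα.le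
  refine ⟨∫ ξ, ‖((((‖ξ‖ ^ α) ^ 2 : ℝ)) : ℂ) * fourier φ ξ‖ ∂haar p, fun t ht x => ?_⟩
  have i1 := integrable_fourierInv_multiplier hφ
    (w := fun ξ => Real.exp (-t * ‖ξ‖ ^ α)) (by fun_prop)
  have i2 := integrable_fourierInv_multiplier hφ (w := fun ξ => ‖ξ‖ ^ α) hc
  have i0 : Integrable (fourier φ) (haar p) := by
    simpa using integrable_fourierInv_multiplier hφ (w := fun _ => 1) continuous_const
  have i3 := integrable_fourierInv_multiplier hφ (w := fun ξ => (‖ξ‖ ^ α) ^ 2) (hc.pow 2)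
  have e : fourierInv (fun ξ => (Real.exp (-t * ‖ξ‖ ^ α) : ℂ) * fourier φ ξ) x
        - φ x + t * vladimirov α φ x
      = fourierInv (fun ξ => ((Real.exp (-(t * ‖ξ‖ ^ α)) - 1 + t * ‖ξ‖ ^ α : ℝ) : ℂ)
          * fourier φ ξ) x := by
    rw [← fourierInv_fourier hφ x]
    simp only [vladimirov, fourierInv]
    have hχ : ∀ g : ℚ_[p] → ℂ, Integrable g (haar p) →
        Integrable (fun ξ => chi (-(x * ξ)) * g ξ) (haar p) := fun g hg =>
      integrable_chi_mul hg (by fun_prop)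
    have i4 : Integrable (fun ξ => chi (-(x * ξ)) * ((Real.exp (-t * ‖ξ‖ ^ α) : ℂ) * fourier φ ξ)
        - chi (-(x * ξ)) * fourier φ ξ) (haar p) := (hχ _ i1).sub (hχ _ i0)
    rw [← integral_const_mul, ← integral_sub (hχ _ i1) (hχ _ i0),
      ← integral_add i4 ((hχ _ i2).const_mul _)]
    refine integral_congr_ae (Eventually.of_forall fun ξ => ?_)
    simp only [neg_mul]
    push_cast
    ring
  rw [e]
  refine (norm_fourierInv_le _ x).trans ?_
  rw [← integral_mul_const]
  refine integral_mono (integrable_fourierInv_multiplier hφ (by fun_prop)).norm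
    (i3.norm.mul_const _) fun ξ => ?_
  simp only [norm_mul, Complex.norm_real, Real.norm_eq_abs]
  rw [mul_right_comm]
  refine mul_le_mul_of_nonneg_right ?_ (norm_nonneg _)
  refine (abs_exp_neg_sub_one_add_le_sq (by positivity)).trans (le_of_eq ?_)
  rw [abs_of_nonneg (by positivity)]
  ring

lemma tendsto_inv_mul_of_hasDerivAt {f : ℝ → ℝ} {c : ℝ} (h : HasDerivAt f c 0) :
    Tendsto (fun t : ℝ => t⁻¹ * (f t - f 0)) (𝓝[>] 0) (𝓝 c) := by
  have := h.tendsto_slope_zero_right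
  simpa using this

/-- The difference quotients of the semigroup on a test function converge uniformly. -/
lemma exists_tendsto_norm_ballConv_sub_le {N : ℤ} {α : ℝ} (hα : 0 < α) {φ : ℚ_[p] → ℂ}
    (hφ : φ ∈ testFunctions p N) :
    ∃ δ : ℝ → ℝ, Tendsto δ (𝓝[>] 0) (𝓝 0) ∧ ∀ t : ℝ, 0 < t → ∀ x,
      ‖(t : ℂ)⁻¹ * (φ x - ballConv N α t φ x)
        - (vladimirov α φ x - (lam p N α : ℂ) * φ x)‖ ≤ δ t := by
  obtain ⟨K, hK⟩ := exists_norm_fourierInv_exp_sub_le hα hφ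
  have i0 : Integrable (fourier φ) (haar p) := by
    simpa using integrable_fourierInv_multiplier hφ (w := fun _ => 1) continuous_const
  set M₀ := ∫ ξ, ‖fourier φ ξ‖ ∂haar p
  set M₁ := ∫ ξ, ‖((‖ξ‖ ^ α : ℝ) : ℂ) * fourier φ ξ‖ ∂haar p
  set I := ∫ y, φ y ∂ballMeasure p N
  set L := lam p N α
  have hM₀ : ∀ x, ‖φ x‖ ≤ M₀ := fun x => by
    rw [← fourierInv_fourier hφ x]
    exact norm_fourierInv_le _ x
  have hM₁ : ∀ x, ‖vladimirov α φ x‖ ≤ M₁ := norm_fourierInv_le _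
  refine ⟨fun t => |L - t⁻¹ * (Real.exp (L * t) - 1)| * M₀ + |Real.exp (L * t) - 1| * M₁
    + Real.exp (L * t) * (K * t) + |t⁻¹ * cCoeff p N α t| * ‖I‖, ?_, fun t ht x => ?_⟩
  · have h2 : HasDerivAt (fun t : ℝ => Real.exp (L * t)) L 0 := by
      simpa using ((hasDerivAt_id (0 : ℝ)).const_mul L).exp
    have h3 := tendsto_inv_mul_of_hasDerivAt h2
    have h4 := tendsto_inv_mul_of_hasDerivAt (hasDerivAt_cCoeff_zero (p := p) N hα)
    have h5 : Tendsto (fun t : ℝ => Real.exp (L * t)) (𝓝[>] 0) (𝓝 1) := by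
      simpa using h2.continuousAt.tendsto.mono_left nhdsWithin_le_nhds
    have h6 : Tendsto (fun t : ℝ => t) (𝓝[>] 0) (𝓝 0) := tendsto_id.mono_left nhdsWithin_le_nhds
    simp only [mul_zero, Real.exp_zero] at h3
    simp only [cCoeff_zero, sub_zero] at h4
    have := (((h3.const_sub L).abs.mul_const M₀).add ((h5.sub_const 1).abs.mul_const M₁)).add
      (h5.mul (h6.const_mul K)) |>.add (h4.abs.mul_const ‖I‖)
    simpa using this
  · rw [ballConv_of_mem_testFunctions hα ht hφ]
    have hR := hK t ht x
    set R := fourierInv (fun ξ => (Real.exp (-t * ‖ξ‖ ^ α) : ℂ) * fourier φ ξ) x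
        - φ x + t * vladimirov α φ x with hRdef
    have eG : fourierInv (fun ξ => (Real.exp (-t * ‖ξ‖ ^ α) : ℂ) * fourier φ ξ) x
        = φ x - t * vladimirov α φ x + R := by rw [hRdef]; ring
    have ht' : (t : ℂ) ≠ 0 := by exact_mod_cast ht.ne'
    have e : (t : ℂ)⁻¹ * (φ x - ((Real.exp (L * t) : ℂ) * (φ x - t * vladimirov α φ x + R)
          + (cCoeff p N α t : ℂ) * I)) - (vladimirov α φ x - (L : ℂ) * φ x)
        = ((L - t⁻¹ * (Real.exp (L * t) - 1) : ℝ) : ℂ) * φ x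
          + ((Real.exp (L * t) - 1 : ℝ) : ℂ) * vladimirov α φ x
          - (Real.exp (L * t) : ℂ) * ((t : ℂ)⁻¹ * R)
          - ((t⁻¹ * cCoeff p N α t : ℝ) : ℂ) * I := by
      push_cast
      field_simp
      ring
    rw [eG, e]
    refine (norm_sub_le _ _).trans (add_le_add ((norm_sub_le _ _).trans
      (add_le_add ((norm_add_le _ _).trans (add_le_add ?_ ?_)) ?_)) ?_)
    · rw [norm_mul, Complex.norm_real, Real.norm_eq_abs]
      exact mul_le_mul_of_nonneg_left (hM₀ x) (abs_nonneg _)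
    · rw [norm_mul, Complex.norm_real, Real.norm_eq_abs]
      exact mul_le_mul_of_nonneg_left (hM₁ x) (abs_nonneg _)
    · rw [norm_mul, Complex.norm_real, Real.norm_eq_abs, Real.abs_exp, norm_mul, norm_inv,
        Complex.norm_real, Real.norm_eq_abs, abs_of_pos ht]
      refine mul_le_mul_of_nonneg_left ?_ (Real.exp_nonneg _)
      rw [inv_mul_le_iff₀ ht]
      linarith
    · rw [norm_mul, Complex.norm_real, Real.norm_eq_abs]

end Vladimirov

/-! ### Generators and commuting operators -/

section Generator

variable {E : Type*} [NormedAddCommGroup E] [NormedSpace ℂ E]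

lemma tendsto_semigroupGenerator {T : ℝ → E →ₗ[ℂ] E} (u : (semigroupGenerator T).domain) :
    Tendsto (fun t : ℝ => (t : ℂ)⁻¹ • ((u : E) - T t u)) (𝓝[>] 0)
      (𝓝 (semigroupGenerator T u)) :=
  u.2.choose_spec

lemma semigroupGenerator_apply_of_tendsto {T : ℝ → E →ₗ[ℂ] E} {u v : E}
    (h : Tendsto (fun t : ℝ => (t : ℂ)⁻¹ • (u - T t u)) (𝓝[>] 0) (𝓝 v)) :
    ∃ hu : u ∈ (semigroupGenerator T).domain, semigroupGenerator T ⟨u, hu⟩ = v :=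
  ⟨⟨v, h⟩, tendsto_nhds_unique (tendsto_semigroupGenerator ⟨u, ⟨v, h⟩⟩) h⟩

/-- A continuous operator commuting with a semigroup commutes with its generator. -/
lemma semigroupGenerator_apply_of_commute {T : ℝ → E →ₗ[ℂ] E} {S : E →ₗ[ℂ] E} (hS : Continuous S)
    (h : ∀ t u, T t (S u) = S (T t u)) (u : (semigroupGenerator T).domain) :
    ∃ hu : S u ∈ (semigroupGenerator T).domain,
      semigroupGenerator T ⟨S u, hu⟩ = S (semigroupGenerator T u) := by
  refine semigroupGenerator_apply_of_tendsto ?_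
  refine ((hS.tendsto _).comp (tendsto_semigroupGenerator u)).congr fun t => ?_
  simp only [Function.comp, map_smul, map_sub, h]

end Generator

/-! ### Convolution operators on the ball -/

namespace Vladimirov

variable {p : ℕ} [Fact p.Prime]

lemma measurePreserving_sub_left {N : ℤ} {x : ℚ_[p]} (hx : x ∈ ball p N) :
    MeasurePreserving (fun y => x - y) (ballMeasure p N) (ballMeasure p N) := by
  have h := ((haar p).measurePreserving_sub_left x).restrict_preimage (measurableSet_ball N)
  have e : (fun y => x - y) ⁻¹' ball p N = ball p N := by
    ext y
    refine ⟨fun hy => ?_, fun hy => sub_mem_ball hx hy⟩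
    simpa using sub_mem_ball hx (Set.mem_preimage.1 hy)
  rwa [e] at h

/-- Convolution with the kernel `k` over the ball `B_N`. -/
noncomputable def kernelConv (N : ℤ) (k f : ℚ_[p] → ℂ) (x : ℚ_[p]) : ℂ :=
  ∫ y, k (x - y) * f y ∂ballMeasure p N

lemma ae_mem_ball (N : ℤ) : ∀ᵐ x ∂ballMeasure p N, x ∈ ball p N :=
  ae_restrict_mem (measurableSet_ball N)

lemma integrable_kernelConv {N : ℤ} {k f : ℚ_[p] → ℂ} (hk : Measurable k) {C : ℝ}
    (hC : ∀ x, ‖k x‖ ≤ C) (hf : Integrable f (ballMeasure p N)) (x : ℚ_[p]) :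
    Integrable (fun y => k (x - y) * f y) (ballMeasure p N) :=
  hf.bdd_mul (hk.comp (by fun_prop)).aestronglyMeasurable (Eventually.of_forall fun y => hC _)

lemma kernelConv_kernelConv {N : ℤ} {k l f : ℚ_[p] → ℂ} (hk : Measurable k) {C : ℝ}
    (hC : ∀ x, ‖k x‖ ≤ C) (hl : Measurable l) {D : ℝ} (hD : ∀ x, ‖l x‖ ≤ D)
    (hf : Integrable f (ballMeasure p N)) (x : ℚ_[p]) :
    kernelConv N k (kernelConv N l f) x
      = ∫ w, (∫ y, k (x - y) * l (y - w) ∂ballMeasure p N) * f w ∂ballMeasure p N := by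
  have hF : Integrable (Function.uncurry fun y w : ℚ_[p] => k (x - y) * (l (y - w) * f w))
      ((ballMeasure p N).prod (ballMeasure p N)) := by
    have h1 : Integrable (fun z : ℚ_[p] × ℚ_[p] => f z.2)
        ((ballMeasure p N).prod (ballMeasure p N)) := hf.comp_snd _
    refine ((h1.bdd_mul (c := D) (f := fun z : ℚ_[p] × ℚ_[p] => l (z.1 - z.2)) ?_ ?_).bdd_mul
      (c := C) (f := fun z : ℚ_[p] × ℚ_[p] => k (x - z.1)) ?_ ?_)
    · exact (hl.comp (by fun_prop)).aestronglyMeasurable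
    · exact Eventually.of_forall fun _ => hD _
    · exact (hk.comp (by fun_prop)).aestronglyMeasurable
    · exact Eventually.of_forall fun _ => hC _
  simp only [kernelConv, ← integral_const_mul, ← integral_mul_const]
  rw [integral_integral_swap hF]
  simp only [mul_assoc]

/-- Convolutions over the compact abelian group `B_N` commute. -/
lemma kernelConv_comm {N : ℤ} {k l f : ℚ_[p] → ℂ} (hk : Measurable k) {C : ℝ}
    (hC : ∀ x, ‖k x‖ ≤ C) (hl : Measurable l) {D : ℝ} (hD : ∀ x, ‖l x‖ ≤ D)
    (hf : Integrable f (ballMeasure p N)) {x : ℚ_[p]} (hx : x ∈ ball p N) :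
    kernelConv N k (kernelConv N l f) x = kernelConv N l (kernelConv N k f) x := by
  rw [kernelConv_kernelConv hk hC hl hD hf, kernelConv_kernelConv hl hD hk hC hf]
  refine integral_congr_ae ?_
  filter_upwards [ae_mem_ball N] with w hw
  -- The reflection `y ↦ x + w - y` of `B_N` exchanges the two convolutions.
  have h := (measurePreserving_sub_left (add_mem_ball hx hw)).integral_comp
    (MeasurableEquiv.subLeft (x + w)).measurableEmbedding
    (fun y => l (x - y) * k (y - w))
  rw [← h]
  congr 1
  refine integral_congr_ae (Eventually.of_forall fun y => ?_)
  simp only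
  rw [mul_comm]
  congr 2 <;> ring

/-! ### Averages over small balls -/

/-- The normalized indicator function of the ball of radius `p ^ (-m)`. -/
noncomputable def avgKernel (m : ℤ) : ℚ_[p] → ℂ :=
  (ball p (-m)).indicator fun _ => (((p : ℝ) ^ m : ℝ) : ℂ)

lemma measurable_avgKernel (m : ℤ) : Measurable (avgKernel (p := p) m) :=
  measurable_const.indicator (measurableSet_ball _)

lemma norm_avgKernel (m : ℤ) (x : ℚ_[p]) :
    ‖avgKernel m x‖ = (ball p (-m)).indicator (fun _ => (p : ℝ) ^ m) x := by
  have hp : (0 : ℝ) < p := one_pos.trans one_lt_natCast_prime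
  by_cases hx : x ∈ ball p (-m)
  · rw [avgKernel, Set.indicator_of_mem hx, Set.indicator_of_mem hx, Complex.norm_real,
      Real.norm_of_nonneg (by positivity)]
  · rw [avgKernel, Set.indicator_of_notMem hx, Set.indicator_of_notMem hx, norm_zero]

lemma norm_avgKernel_le (m : ℤ) (x : ℚ_[p]) : ‖avgKernel m x‖ ≤ (p : ℝ) ^ m := by
  have hp : (0 : ℝ) < p := one_pos.trans one_lt_natCast_prime
  rw [norm_avgKernel]
  exact Set.indicator_le_self' (fun _ _ => by positivity) x

lemma avgKernel_neg (m : ℤ) (x : ℚ_[p]) : avgKernel m (-x) = avgKernel m x := by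
  by_cases hx : x ∈ ball p (-m)
  · rw [avgKernel, Set.indicator_of_mem hx, Set.indicator_of_mem (neg_mem_ball.2 hx)]
  · rw [avgKernel, Set.indicator_of_notMem hx,
      Set.indicator_of_notMem fun h => hx (neg_mem_ball.1 h)]

lemma avgKernel_add (m : ℤ) (x : ℚ_[p]) {h : ℚ_[p]} (hh : h ∈ ball p (-m)) :
    avgKernel m (x + h) = avgKernel m x := by
  by_cases hx : x ∈ ball p (-m)
  · rw [avgKernel, Set.indicator_of_mem hx, Set.indicator_of_mem (add_mem_ball hx hh)]
  · rw [avgKernel, Set.indicator_of_notMem hx, Set.indicator_of_notMem (add_notMem_ball hx hh)]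

lemma integral_norm_avgKernel {m N : ℤ} (hm : -m ≤ N) {x : ℚ_[p]} (hx : x ∈ ball p N) :
    ∫ y, ‖avgKernel m (x - y)‖ ∂ballMeasure p N = 1 := by
  have hp : (0 : ℝ) < p := one_pos.trans one_lt_natCast_prime
  rw [(measurePreserving_sub_left hx).integral_comp
    (MeasurableEquiv.subLeft x).measurableEmbedding (fun y => ‖avgKernel m y‖)]
  simp only [norm_avgKernel]
  rw [integral_indicator (measurableSet_ball _), setIntegral_const, ballMeasure,
    measureReal_restrict_apply (measurableSet_ball _),
    Set.inter_eq_left.2 (ball_mono hm), haarReal_ball, smul_eq_mul, ← zpow_add₀ hp.ne']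
  simp

lemma integrable_avgKernel (m N : ℤ) (x : ℚ_[p]) :
    Integrable (fun y => avgKernel m (x - y)) (ballMeasure p N) := by
  simpa using integrable_kernelConv (measurable_avgKernel m) (norm_avgKernel_le m)
    (integrable_const (1 : ℂ)) x

lemma avgKernel_eq_ofReal_norm (m : ℤ) (x : ℚ_[p]) : avgKernel m x = (‖avgKernel m x‖ : ℂ) := by
  rw [norm_avgKernel]
  by_cases hx : x ∈ ball p (-m) <;> simp [avgKernel, hx]

lemma integral_avgKernel {m N : ℤ} (hm : -m ≤ N) {x : ℚ_[p]} (hx : x ∈ ball p N) :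
    ∫ y, avgKernel m (x - y) ∂ballMeasure p N = 1 := by
  have h : (fun y => avgKernel m (x - y)) = fun y => (‖avgKernel m (x - y)‖ : ℂ) :=
    funext fun y => avgKernel_eq_ofReal_norm m (x - y)
  rw [h, integral_complex_ofReal, integral_norm_avgKernel hm hx, Complex.ofReal_one]

lemma lintegral_enorm_avgKernel {m N : ℤ} (hm : -m ≤ N) {x : ℚ_[p]} (hx : x ∈ ball p N) :
    ∫⁻ y, ‖avgKernel m (x - y)‖ₑ ∂ballMeasure p N = 1 := by
  rw [← ofReal_integral_norm_eq_lintegral_enorm (integrable_avgKernel m N x),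
    integral_norm_avgKernel hm hx, ENNReal.ofReal_one]

/-- Jensen's inequality for the average over a small ball. -/
lemma enorm_kernelConv_avgKernel_rpow_le {m N : ℤ} (hm : -m ≤ N) {r : ℝ} (hr : 1 ≤ r)
    {f : ℚ_[p] → ℂ} (hf : StronglyMeasurable f) {x : ℚ_[p]} (hx : x ∈ ball p N) :
    ‖kernelConv N (avgKernel m) f x‖ₑ ^ r
      ≤ ∫⁻ y, ‖avgKernel m (x - y)‖ₑ * ‖f y‖ₑ ^ r ∂ballMeasure p N := by
  have hr0 : 0 < r := one_pos.trans_le hr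
  have hK : Measurable fun y : ℚ_[p] => ‖avgKernel m (x - y)‖ₑ :=
    ((measurable_avgKernel m).comp (by fun_prop)).enorm
  -- The average at `x` is the mean with respect to a probability measure `ν`, whose `L^1` norm is
  -- dominated by its `L^r` norm.
  set ν := (ballMeasure p N).withDensity fun y => ‖avgKernel m (x - y)‖ₑ with hν
  have : IsProbabilityMeasure ν :=
    ⟨by rw [hν, withDensity_apply _ MeasurableSet.univ, Measure.restrict_univ,
      lintegral_enorm_avgKernel hm hx]⟩
  have h1 := eLpNorm'_le_eLpNorm'_of_exponent_le (f := f) one_pos hr ν hf.aestronglyMeasurable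
  simp only [eLpNorm', ENNReal.rpow_one, div_one] at h1
  rw [hν, lintegral_withDensity_eq_lintegral_mul _ hK hf.enorm,
    lintegral_withDensity_eq_lintegral_mul _ hK (hf.enorm.pow_const r)] at h1
  refine (ENNReal.rpow_le_rpow (z := r) ((enorm_integral_le_lintegral_enorm _).trans
    ((le_of_eq (lintegral_congr fun y => enorm_mul _ _)).trans h1)) hr0.le).trans (le_of_eq ?_)
  rw [← ENNReal.rpow_mul, one_div_mul_cancel hr0.ne', ENNReal.rpow_one]
  rfl

/-- Averaging over small balls is a contraction of `L^q(B_N)`. -/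
lemma eLpNorm_kernelConv_avgKernel_le {m N : ℤ} (hm : -m ≤ N) {q : ℝ≥0∞} (hq1 : 1 ≤ q)
    (hq : q ≠ ⊤) {f : ℚ_[p] → ℂ} (hf : StronglyMeasurable f) :
    eLpNorm (kernelConv N (avgKernel m) f) q (ballMeasure p N)
      ≤ eLpNorm f q (ballMeasure p N) := by
  have hr : 1 ≤ q.toReal := by simpa using ENNReal.toReal_mono hq hq1
  have hq0 : q ≠ 0 := (one_pos.trans_le hq1).ne'
  rw [eLpNorm_eq_eLpNorm' hq0 hq, eLpNorm_eq_eLpNorm' hq0 hq, eLpNorm', eLpNorm']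
  refine ENNReal.rpow_le_rpow ?_ (by positivity)
  calc ∫⁻ x, ‖kernelConv N (avgKernel m) f x‖ₑ ^ q.toReal ∂ballMeasure p N
      ≤ ∫⁻ x, ∫⁻ y, ‖avgKernel m (x - y)‖ₑ * ‖f y‖ₑ ^ q.toReal ∂ballMeasure p N
          ∂ballMeasure p N := by
        refine lintegral_mono_ae ?_
        filter_upwards [ae_mem_ball N] with x hx
        exact enorm_kernelConv_avgKernel_rpow_le hm hr hf hx
    _ = ∫⁻ y, ∫⁻ x, ‖avgKernel m (x - y)‖ₑ * ‖f y‖ₑ ^ q.toReal ∂ballMeasure p N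
          ∂ballMeasure p N := by
        refine lintegral_lintegral_swap (Measurable.aemeasurable ?_)
        exact (((measurable_avgKernel m).comp (measurable_fst.sub measurable_snd)).enorm).mul
          ((hf.measurable.comp measurable_snd).enorm.pow_const _)
    _ = ∫⁻ y, ‖f y‖ₑ ^ q.toReal ∂ballMeasure p N := by
        refine lintegral_congr_ae ?_
        filter_upwards [ae_mem_ball N] with y hy
        have hK : Measurable fun x : ℚ_[p] => ‖avgKernel m (x - y)‖ₑ :=
          ((measurable_avgKernel m).comp (by fun_prop)).enorm
        rw [lintegral_mul_const _ hK]
        have : ∀ x, avgKernel m (x - y) = avgKernel m (y - x) := fun x => by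
          rw [← avgKernel_neg, neg_sub]
        simp only [this, lintegral_enorm_avgKernel hm hy, one_mul]

/-- Averages over small balls are test functions. -/
lemma kernelConv_avgKernel_mem_testFunctions {m N : ℤ} (hm : -m ≤ N) (f : ℚ_[p] → ℂ) :
    kernelConv N (avgKernel m) f ∈ testFunctions p N := by
  have hp : (0 : ℝ) < p := one_pos.trans one_lt_natCast_prime
  constructor
  · rw [IsLocallyConstant.iff_eventually_eq]
    intro x
    filter_upwards [Metric.closedBall_mem_nhds x (zpow_pos hp (-m))] with z hz
    have hz : z - x ∈ ball p (-m) := by simpa [mem_ball, dist_eq_norm] using hz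
    simp only [kernelConv]
    refine integral_congr_ae (Eventually.of_forall fun y => ?_)
    simp only
    rw [show z - y = x - y + (z - x) by ring, avgKernel_add m _ hz]
  · intro x hx
    by_contra h
    refine hx ?_
    rw [kernelConv, ← integral_zero ℚ_[p] ℂ (μ := ballMeasure p N)]
    refine integral_congr_ae ?_
    filter_upwards [ae_mem_ball N] with y hy
    have : x - y ∉ ball p (-m) := fun h' => h <| by simpa using add_mem_ball (ball_mono hm h') hy
    rw [avgKernel, Set.indicator_of_notMem this, zero_mul]

variable (p) in
/-- The operator of averaging over balls of radius `p ^ (-m)` on `L^q(B_N)`. The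
hypothesis `-m ≤ N` makes the averages live inside `B_N`, so that their mass is one. -/
noncomputable def ballAverage (N m : ℤ) (q : ℝ≥0∞) [hq : Fact (1 ≤ q)] (hm : -m ≤ N) :
    LqBall p N q →ₗ[ℂ] LqBall p N q where
  toFun f := (memLp_of_mem_testFunctions (kernelConv_avgKernel_mem_testFunctions hm f) q).toLp _
  map_add' f g := by
    rw [← MemLp.toLp_add]
    refine MemLp.toLp_congr _ _ (Eventually.of_forall fun x => ?_)
    have hi : ∀ f : LqBall p N q,
        Integrable (fun y => avgKernel m (x - y) * f y) (ballMeasure p N) := fun f =>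
      integrable_kernelConv (measurable_avgKernel m) (norm_avgKernel_le m)
        ((Lp.memLp f).integrable hq.out) x
    simp only [kernelConv, Pi.add_apply]
    rw [← integral_add (hi f) (hi g)]
    refine integral_congr_ae ?_
    filter_upwards [Lp.coeFn_add f g] with y hy
    rw [hy, Pi.add_apply, mul_add]
  map_smul' c f := by
    rw [RingHom.id_apply, ← MemLp.toLp_const_smul]
    refine MemLp.toLp_congr _ _ (Eventually.of_forall fun x => ?_)
    simp only [kernelConv, Pi.smul_apply, smul_eq_mul]
    rw [← integral_const_mul]
    refine integral_congr_ae ?_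
    filter_upwards [Lp.coeFn_smul c f] with y hy
    rw [hy, Pi.smul_apply, smul_eq_mul]
    ring

variable {N m : ℤ} {q : ℝ≥0∞} [hq1 : Fact (1 ≤ q)]

lemma coeFn_ballAverage (hm : -m ≤ N) (f : LqBall p N q) :
    ballAverage p N m q hm f =ᵐ[ballMeasure p N] kernelConv N (avgKernel m) f :=
  (memLp_of_mem_testFunctions (kernelConv_avgKernel_mem_testFunctions hm f) q).coeFn_toLp

lemma norm_ballAverage_le (hq : q ≠ ⊤) (hm : -m ≤ N) (f : LqBall p N q) :
    ‖ballAverage p N m q hm f‖ ≤ ‖f‖ := by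
  rw [Lp.norm_def, Lp.norm_def, eLpNorm_congr_ae (coeFn_ballAverage hm f)]
  exact ENNReal.toReal_mono (Lp.memLp f).2.ne
    (eLpNorm_kernelConv_avgKernel_le hm hq1.out hq (Lp.stronglyMeasurable f))

lemma kernelConv_congr {k f g : ℚ_[p] → ℂ} (h : f =ᵐ[ballMeasure p N] g) :
    kernelConv N k f = kernelConv N k g := by
  ext x
  refine integral_congr_ae ?_
  filter_upwards [h] with y hy
  rw [hy]

lemma coeFn_ballSemigroup (α t : ℝ) (f : LqBall p N q) :
    ballSemigroup p N α q t f =ᵐ[ballMeasure p N] kernelConv N (ballHeatKernel N α t) f :=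
  (memLp_ballConv N α t hq1.out (Lp.memLp f)).coeFn_toLp

lemma ballSemigroup_ballAverage (hm : -m ≤ N) (α t : ℝ) (f : LqBall p N q) :
    ballSemigroup p N α q t (ballAverage p N m q hm f)
      = ballAverage p N m q hm (ballSemigroup p N α q t f) := by
  obtain ⟨C, hC⟩ := exists_bound_ballHeatKernel (p := p) N α t
  refine Lp.ext ?_
  filter_upwards [coeFn_ballSemigroup α t (ballAverage p N m q hm f),
    coeFn_ballAverage hm (ballSemigroup p N α q t f), ae_mem_ball N] with x h1 h2 hx
  rw [h1, h2, kernelConv_congr (coeFn_ballAverage hm f), kernelConv_congr (coeFn_ballSemigroup α t f)]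
  exact kernelConv_comm (measurable_ballHeatKernel N α t) hC (measurable_avgKernel m)
    (norm_avgKernel_le m) ((Lp.memLp f).integrable hq1.out) hx

lemma norm_kernelConv_avgKernel_sub_le (hm : -m ≤ N) {g : ℚ_[p] → ℂ}
    (hg : Integrable g (ballMeasure p N)) {ε : ℝ} {x : ℚ_[p]} (hx : x ∈ ball p N)
    (h : ∀ y ∈ ball p N, x - y ∈ ball p (-m) → ‖g y - g x‖ ≤ ε) :
    ‖kernelConv N (avgKernel m) g x - g x‖ ≤ ε := by
  have e : kernelConv N (avgKernel m) g x - g x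
      = ∫ y, avgKernel m (x - y) * (g y - g x) ∂ballMeasure p N := by
    simp only [mul_sub]
    rw [integral_sub (integrable_kernelConv (measurable_avgKernel m) (norm_avgKernel_le m) hg x)
      ((integrable_avgKernel m N x).mul_const _), integral_mul_const, integral_avgKernel hm hx,
      one_mul]
    rfl
  calc ‖kernelConv N (avgKernel m) g x - g x‖
      ≤ ∫ y, ‖avgKernel m (x - y)‖ * ε ∂ballMeasure p N := by
        rw [e]
        refine norm_integral_le_of_norm_le ((integrable_avgKernel m N x).norm.mul_const _) ?_
        filter_upwards [ae_mem_ball N] with y hy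
        rw [norm_mul]
        by_cases hxy : x - y ∈ ball p (-m)
        · exact mul_le_mul_of_nonneg_left (h y hy hxy) (norm_nonneg _)
        · rw [norm_avgKernel, Set.indicator_of_notMem hxy, zero_mul, zero_mul]
    _ = ε := by rw [integral_mul_const, integral_norm_avgKernel hm hx, one_mul]

/-- Averages over shrinking balls converge in `L^q(B_N)`: this holds for continuous functions by
uniform continuity, and for the others by density. -/
lemma exists_norm_ballAverage_sub_lt (hq : q ≠ ⊤) (f : LqBall p N q) {ε : ℝ} (hε : 0 < ε) :
    ∃ M : ℤ, ∀ m (hm : -m ≤ N), M ≤ m → ‖ballAverage p N m q hm f - f‖ < ε := by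
  have : (ballMeasure p N).Regular := by
    unfold ballMeasure
    exact Measure.Regular.restrict_of_measure_ne_top (haar_ball_ne_top N)
  obtain ⟨g, -, hgε, hgc, hg⟩ := (Lp.memLp f).exists_hasCompactSupport_eLpNorm_sub_le hq
    (ε := ENNReal.ofReal (ε / 4)) (by simpa using hε)
  set G : LqBall p N q := hg.toLp g
  have hfG : ‖f - G‖ ≤ ε / 4 := by
    rw [Lp.norm_def]
    refine ENNReal.toReal_le_of_le_ofReal (by positivity) ((le_of_eq ?_).trans hgε)
    refine eLpNorm_congr_ae ?_
    filter_upwards [Lp.coeFn_sub f G, hg.coeFn_toLp] with x h1 h2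
    rw [h1, Pi.sub_apply, Pi.sub_apply, h2]
  set V : ℝ := (measureUnivNNReal (ballMeasure p N) : ℝ) ^ q.toReal⁻¹
  have hV : 0 ≤ V := by positivity
  obtain ⟨δ, hδ, H⟩ := Metric.uniformContinuousOn_iff.1
    ((isCompact_ball p N).uniformContinuousOn_of_continuous hgc.continuousOn)
    (ε / (4 * (V + 1))) (by positivity)
  obtain ⟨M, -, hM⟩ := exists_ball_neg_lt (p := p) hδ N
  refine ⟨M, fun m hm hMm => ?_⟩
  have hSG : ‖ballAverage p N m q hm G - G‖ ≤ ε / 4 := by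
    have hb : ∀ᵐ x ∂ballMeasure p N,
        ‖(ballAverage p N m q hm G - G : LqBall p N q) x‖ ≤ ε / (4 * (V + 1)) := by
      filter_upwards [Lp.coeFn_sub (ballAverage p N m q hm G) G, coeFn_ballAverage hm G,
        hg.coeFn_toLp, ae_mem_ball N] with x h1 h2 h3 hx
      rw [h1, Pi.sub_apply, h2, h3, kernelConv_congr hg.coeFn_toLp]
      refine norm_kernelConv_avgKernel_sub_le hm (hg.integrable hq1.out) hx fun y hy hxy => ?_
      have hd : dist y x < δ := by
        rw [dist_comm, dist_eq_norm]
        exact lt_of_le_of_lt (ball_mono (neg_le_neg hMm) hxy) hM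
      rw [← dist_eq_norm]
      exact (H y hy x hx hd).le
    refine (Lp.norm_le_of_ae_bound (by positivity) hb).trans ?_
    calc V * (ε / (4 * (V + 1))) = (V / (V + 1)) * (ε / 4) := by field_simp
      _ ≤ 1 * (ε / 4) := by
        gcongr
        rw [div_le_one (by positivity)]
        linarith
      _ = ε / 4 := one_mul _
  calc ‖ballAverage p N m q hm f - f‖
      = ‖ballAverage p N m q hm (f - G) + (ballAverage p N m q hm G - G) - (f - G)‖ := by
        rw [map_sub]
        congr 1
        abel
    _ ≤ ‖ballAverage p N m q hm (f - G)‖ + ‖ballAverage p N m q hm G - G‖ + ‖f - G‖ :=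
        (norm_sub_le _ _).trans (add_le_add_left (norm_add_le _ _) _)
    _ ≤ ε / 4 + ε / 4 + ε / 4 := by
        gcongr
        exact (norm_ballAverage_le hq hm _).trans hfG
    _ < ε := by linarith

/-! ### The generator on test functions -/

lemma memLp_vladimirov_sub {α : ℝ} (hα : 0 < α) {φ : ℚ_[p] → ℂ} (hφ : φ ∈ testFunctions p N)
    (q : ℝ≥0∞) : MemLp (fun x => vladimirov α φ x - (lam p N α : ℂ) * φ x) q
      (ballMeasure p N) := by
  have hi : Integrable (fun ξ => ((‖ξ‖ ^ α : ℝ) : ℂ) * fourier φ ξ) (haar p) :=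
    integrable_fourierInv_multiplier hφ (continuous_norm.rpow_const fun _ => Or.inr hα.le)
  refine MemLp.sub (MemLp.of_bound (continuous_fourierInv hi).aestronglyMeasurable _
    (Eventually.of_forall (norm_fourierInv_le _)))
    ((memLp_of_mem_testFunctions hφ q).const_mul _)

lemma generatorA_apply_of_mem_testFunctions {α : ℝ} (hα : 0 < α) {φ : ℚ_[p] → ℂ}
    (hφ : φ ∈ testFunctions p N) :
    ∃ h : (memLp_of_mem_testFunctions hφ q).toLp φ ∈ (generatorA p N α q).domain,
      generatorA p N α q ⟨_, h⟩ = (memLp_vladimirov_sub hα hφ q).toLp _ := by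
  obtain ⟨δ, hδ, H⟩ := exists_tendsto_norm_ballConv_sub_le hα hφ
  refine semigroupGenerator_apply_of_tendsto ?_
  rw [tendsto_iff_norm_sub_tendsto_zero]
  set V : ℝ := (measureUnivNNReal (ballMeasure p N) : ℝ) ^ q.toReal⁻¹
  refine squeeze_zero' (g := fun t => V * δ t) (Eventually.of_forall fun t => norm_nonneg _) ?_
    (by simpa using hδ.const_mul V)
  filter_upwards [self_mem_nhdsWithin] with t ht
  have ht : 0 < t := ht
  refine Lp.norm_le_of_ae_bound ((norm_nonneg _).trans (H t ht 0)) ?_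
  have hT : ballSemigroup p N α q t ((memLp_of_mem_testFunctions hφ q).toLp φ)
      =ᵐ[ballMeasure p N] ballConv N α t φ := by
    refine (coeFn_ballSemigroup α t _).trans (Eventually.of_forall fun x => ?_)
    rw [kernelConv_congr (memLp_of_mem_testFunctions hφ q).coeFn_toLp]
    rfl
  set u := (memLp_of_mem_testFunctions hφ q).toLp φ with hu
  set v := (memLp_vladimirov_sub hα hφ q).toLp _ with hv
  filter_upwards [Lp.coeFn_sub ((t : ℂ)⁻¹ • (u - ballSemigroup p N α q t u)) v,
    Lp.coeFn_smul (t : ℂ)⁻¹ (u - ballSemigroup p N α q t u),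
    Lp.coeFn_sub u (ballSemigroup p N α q t u), hT,
    (memLp_of_mem_testFunctions hφ q).coeFn_toLp,
    (memLp_vladimirov_sub hα hφ q).coeFn_toLp] with x h1 h2 h3 h4 h5 h6
  rw [h1, Pi.sub_apply, h2, Pi.smul_apply, h3, Pi.sub_apply, h4, h5, h6, smul_eq_mul]
  exact H t ht x

lemma generatorA_ballAverage (hq : q ≠ ⊤) (hm : -m ≤ N) (α : ℝ)
    (u : (generatorA p N α q).domain) :
    ∃ h : ballAverage p N m q hm u ∈ (generatorA p N α q).domain,
      generatorA p N α q ⟨_, h⟩ = ballAverage p N m q hm (generatorA p N α q u) :=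
  semigroupGenerator_apply_of_commute
    ((ballAverage p N m q hm).mkContinuous 1 fun f => by
      simpa using norm_ballAverage_le hq hm f).continuous
    (fun t f => ballSemigroup_ballAverage hm α t f) u

lemma exists_graphNorm_sub_lt (hq : q ≠ ⊤) (α : ℝ) (u : (generatorA p N α q).domain) {ε : ℝ}
    (hε : 0 < ε) :
    ∃ (m : ℤ) (hm : -m ≤ N) (h : ballAverage p N m q hm u ∈ (generatorA p N α q).domain),
      graphNorm (generatorA p N α q) (u - ⟨_, h⟩) < ε := by
  obtain ⟨M₁, h₁⟩ := exists_norm_ballAverage_sub_lt hq (u : LqBall p N q) (half_pos hε)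
  obtain ⟨M₂, h₂⟩ := exists_norm_ballAverage_sub_lt hq (generatorA p N α q u) (half_pos hε)
  obtain ⟨m, hm, hm₁, hm₂⟩ : ∃ m : ℤ, -m ≤ N ∧ M₁ ≤ m ∧ M₂ ≤ m :=
    ⟨max (max M₁ M₂) (-N), by omega, by omega, by omega⟩
  obtain ⟨h, e⟩ := generatorA_ballAverage hq hm α u
  refine ⟨m, hm, h, ?_⟩
  have e₁ := h₁ m hm hm₁
  have e₂ := h₂ m hm hm₂
  rw [norm_sub_rev] at e₁ e₂
  rw [graphNorm, LinearPMap.map_sub, e, AddSubgroupClass.coe_sub]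
  linarith

end Vladimirov

theorem proposition2 (p : ℕ) [Fact p.Prime] (N : ℤ) (α : ℝ) (hα : 0 < α)
    (q : ENNReal) [Fact (1 ≤ q)] (hq : q ≠ ⊤) :
    (∀ (φ : ℚ_[p] → ℂ) (hφ : φ ∈ Vladimirov.testFunctions p N),
      ∃ h : (Vladimirov.memLp_of_mem_testFunctions hφ q).toLp φ ∈
          (Vladimirov.generatorA p N α q).domain,
        ∀ᵐ x ∂(Vladimirov.ballMeasure p N),
          (Vladimirov.generatorA p N α q ⟨_, h⟩ : ℚ_[p] → ℂ) x =
            Vladimirov.vladimirov α φ x - (Vladimirov.lam p N α : ℂ) * φ x) ∧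
    (∀ (u : (Vladimirov.generatorA p N α q).domain) (ε : ℝ), 0 < ε →
      ∃ (φ : ℚ_[p] → ℂ) (hφ : φ ∈ Vladimirov.testFunctions p N)
        (h : (Vladimirov.memLp_of_mem_testFunctions hφ q).toLp φ ∈
          (Vladimirov.generatorA p N α q).domain),
        graphNorm (Vladimirov.generatorA p N α q) (u - ⟨_, h⟩) < ε) := by
  open Vladimirov in
  constructor
  · intro φ hφ
    obtain ⟨h, e⟩ := generatorA_apply_of_mem_testFunctions (q := q) hα hφ
    refine ⟨h, ?_⟩
    rw [e]
    exact MemLp.coeFn_toLp _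
  · intro u ε hε
    obtain ⟨m, hm, h, hlt⟩ := exists_graphNorm_sub_lt hq α u hε
    exact ⟨_, kernelConv_avgKernel_mem_testFunctions hm (u : LqBall p N q), h, hlt⟩
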